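/- All spaces are topological spaces. Let $S^0=\{\mathrm{true},\mathrm{false}\}$ (discrete, base point $\mathrm{true}$) and $S^{k+1}=\mathrm{Susp}\,S^k$, where for a pointed space $X$ the unreduced suspension $\mathrm{Susp}\,X$ is the quotient of $X\times[0,1]$ collapsing $X\times\{0\}$ to a point $\mathsf{north}$ (the base point) and $X\times\{1\}$ to a point $\mathsf{south}$; $\mathrm{merid}_x$ is the path $t\mapsto[x,t]$ from $\mathsf{north}$ to $\mathsf{south}$, and $\sigma_x=\mathrm{merid}_x\cdot\mathrm{merid}_\star^{-1}$. The join $X*Y$ is the quotient of $X\times Y\times[0,1]$ by $(x,y,0)\sim(x,y',0)$ and $(x,y,1)\sim(x',y,1)$; write $\mathrm{inl}\,x=[x,\cdot,0]$, $\mathrm{inr}\,y=[\cdot,y,1]$, let $\mathrm{push}_{x,y}$ be the path $t\mapsto[x,y,t]$, and take $\mathrm{inl}\,\star$ as base point. Put $$\ell_{x,y}=\mathrm{push}_{\star,\star}\cdot\mathrm{push}_{x,\star}^{-1}\cdot\mathrm{push}_{x,y}\cdot\mathrm{push}_{\star,y}^{-1},$$ a loop at the base point of $X*Y$. Let $A$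 be a pointed space. For pointed maps $f,g:X*Y\to A$, let $f+^*g:X*Y\to A$ send all $\mathrm{inl}\,x$ and $\mathrm{inr}\,y$ to $\star_A$ and be given along $\mathrm{push}_{x,y}$ by the loop $(f\circ\ell_{x,y})\cdot(g\circ\ell_{x,y})$. For pointed maps $f,g:\mathrm{Susp}\,X\to A$, let $f+^{\mathrm{Susp}}g$ send both poles to $\star_A$ and be given along $\mathrm{merid}_x$ by the loop $(f\circ\sigma_x)\cdot(g\circ\sigma_x)$. Define $\smile\,:S^n\times S^m\to S^{n+m}$ by recursion on $n$: $\mathrm{false}\smile y=y$ and $\mathrm{true}\smile y=\star$ for $n=0$, and $\mathrm{merid}_x(t)\smile y=\sigma_{x\smile y}(t)$ for the step from $n$ to $n+1$. Let $F_{n,m}:S^n*S^m\to S^{n+m+1}$ be the pointed map with $F_{n,m}(\mathrm{inl}\,x)=\mathsf{north}$, $F_{n,m}(\mathrm{inr}\,y)=\mathsf{south}$ and $F_{n,m}(\mathrm{push}_{x,y}(t))=\mathrm{merid}_{x\smile y}(t)$. For $n,m\ge 0$, let $\pi_{n+m+1}(A)$ and $\pi^*_{n+m+1}(A)$ be the sets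 of pointed homotopy classes of pointed maps $S^{n+m+1}\to A$ and $S^n*S^m\to A$, respectively. **Proposition 6.9.** Let $n,m\ge 0$ and let $A$ be a pointed space. 1. The operation $+^{\mathrm{Susp}}$ induces the group structure of $\pi_{n+m+1}(A)$: $[f]+[g]=[f+^{\mathrm{Susp}}g]$ is well defined and makes $\pi_{n+m+1}(A)$ a group. 2. $[f]+[g]=[f+^*g]$ is well defined and makes $\pi^*_{n+m+1}(A)$ a group. 3. For all pointed maps $f,g:S^{n+m+1}\to A$, the maps $(f+^{\mathrm{Susp}}g)\circ F_{n,m}$ and $(f\circ F_{n,m})+^*(g\circ F_{n,m})$ are pointed homotopic. 4. Precomposition $[f]\mapsto[f\circ F_{n,m}]$ is a group isomorphism $\pi_{n+m+1}(A)\cong\pi^*_{n+m+1}(A)$. The same isomorphism is given by precomposition with the pointed map $S^n*S^m\to S^{n+m+1}$ that sends all $\mathrm{inl}\,x$ and $\mathrm{inr}\,y$ to $\mathsf{north}$ and is given along $\mathrm{push}_{x,y}$ by the loop $\sigma_{x\smile y}$. -/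

import Mathlib

open scoped unitInterval

universe u v w

namespace JoinHomotopy

/-- A pointed space: a topological space with a base point. -/
structure PointedSpace where
  carrier : Type u
  [top : TopologicalSpace carrier]
  pt : carrier

instance : CoeSort PointedSpace.{u} (Type u) := ⟨PointedSpace.carrier⟩

instance (X : PointedSpace.{u}) : TopologicalSpace X := X.top

/-- Pointed continuous maps. -/
def PointedMap (X : PointedSpace.{u}) (Y : PointedSpace.{v}) : Type (max u v) :=
  {f : C(X, Y) // f X.pt = Y.pt}

infixr:25 " →⋆ " => PointedMap

/-- Composition `g ∘ f` of pointed maps. -/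
def PointedMap.comp {X : PointedSpace.{u}} {Y : PointedSpace.{v}} {Z : PointedSpace.{w}}
    (g : Y →⋆ Z) (f : X →⋆ Y) : X →⋆ Z :=
  ⟨g.1.comp f.1, by rw [ContinuousMap.comp_apply, f.2, g.2]⟩

/-- Pointed homotopy: homotopy of maps that is constant on the base point. -/
def PointedHomotopic {X : PointedSpace.{u}} {Y : PointedSpace.{v}} (f g : X →⋆ Y) : Prop :=
  ContinuousMap.HomotopicRel f.1 g.1 {X.pt}

def pointedSetoid (X : PointedSpace.{u}) (Y : PointedSpace.{v}) : Setoid (X →⋆ Y) where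
  r := PointedHomotopic
  iseqv :=
    { refl := fun f => ContinuousMap.HomotopicRel.refl f.1
      symm := fun h => ContinuousMap.HomotopicRel.symm h
      trans := fun h k => ContinuousMap.HomotopicRel.trans h k }

/-- The set of pointed homotopy classes of pointed maps `X → Y`. -/
def HtpyClasses (X : PointedSpace.{u}) (Y : PointedSpace.{v}) : Type (max u v) :=
  Quotient (pointedSetoid X Y)

/-- The pointed homotopy class of a pointed map. -/
def cls {X : PointedSpace.{u}} {Y : PointedSpace.{v}} (f : X →⋆ Y) : HtpyClasses X Y :=
  Quotient.mk (pointedSetoid X Y) f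

/-- The action of a pointed map on loops, `Ω X → Ω Y`. -/
def PointedMap.loopMap {X : PointedSpace.{u}} {Y : PointedSpace.{v}} (f : X →⋆ Y)
    (p : Path X.pt X.pt) : Path Y.pt Y.pt :=
  (p.map f.1.continuous).cast f.2.symm f.2.symm

theorem continuous_loopMap {X : PointedSpace.{u}} {Y : PointedSpace.{v}} (f : X →⋆ Y) :
    Continuous f.loopMap := by
  rw [← Path.continuous_uncurry_iff]
  have h : Continuous fun q : Path X.pt X.pt × I => f.1 (q.1 q.2) := by fun_prop
  exact h

section Suspension

/-- The gluing relation on `X × [0,1]` that collapses `X × {0}` to one point and `X × {1}` to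
another one. -/
def suspSetoid (X : Type u) : Setoid (X × I) where
  r p q := p = q ∨ (p.2 = 0 ∧ q.2 = 0) ∨ (p.2 = 1 ∧ q.2 = 1)
  iseqv :=
    { refl := fun _ => Or.inl rfl
      symm := by
        rintro p q (h | ⟨h, k⟩ | ⟨h, k⟩)
        · exact Or.inl h.symm
        · exact Or.inr (Or.inl ⟨k, h⟩)
        · exact Or.inr (Or.inr ⟨k, h⟩)
      trans := by
        have h01 : (0 : I) ≠ 1 := zero_ne_one
        rintro p q r hpq hqr
        grind }

/-- The (unreduced) suspension of a pointed space, with the quotient topology, pointed by the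
north pole (the image of `X × {0}`). -/
def Susp (X : PointedSpace.{u}) : PointedSpace.{u} where
  carrier := Quotient (suspSetoid X)
  pt := Quotient.mk (suspSetoid X) (X.pt, 0)

variable {X : PointedSpace.{u}} {Y : PointedSpace.{v}} {Z : PointedSpace.{w}}

def Susp.mk (p : X × I) : Susp X := Quotient.mk (suspSetoid X) p

def Susp.north : Susp X := Susp.mk (X.pt, 0)

def Susp.south : Susp X := Susp.mk (X.pt, 1)

theorem Susp.continuous_mk : Continuous (Susp.mk : X × I → Susp X) :=
  continuous_quotient_mk'

theorem Susp.surjective_mk : Function.Surjective (Susp.mk : X × I → Susp X) :=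
  Quotient.mk_surjective

theorem Susp.mk_eq_mk_iff {p q : X × I} :
    Susp.mk p = Susp.mk q ↔ p = q ∨ (p.2 = 0 ∧ q.2 = 0) ∨ (p.2 = 1 ∧ q.2 = 1) :=
  Quotient.eq (r := suspSetoid X)

/-- The meridian through `x`, a path from the north pole to the south pole. -/
def Susp.merid (x : X) : Path (Susp.north : Susp X) Susp.south where
  toFun t := Susp.mk (x, t)
  continuous_toFun := Susp.continuous_mk.comp (by fun_prop)
  source' := Susp.mk_eq_mk_iff.2 (Or.inr (Or.inl ⟨rfl, rfl⟩))
  target' := Susp.mk_eq_mk_iff.2 (Or.inr (Or.inr ⟨rfl, rfl⟩))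

theorem Susp.continuous_merid : Continuous (Susp.merid : X → _) := by
  rw [← Path.continuous_uncurry_iff]
  exact Susp.continuous_mk

/-- The map `σ : X → Ω (Susp X)`, `σ x = merid x · (merid ⋆)⁻¹`. -/
noncomputable def Susp.sigma (x : X) : Path (Susp X).pt (Susp X).pt :=
  (Susp.merid x).trans (Susp.merid X.pt).symm

theorem Susp.continuous_sigma : Continuous (Susp.sigma : X → _) := by
  have h := Susp.continuous_merid (X := X)
  exact Path.continuous_trans.comp (h.prodMk continuous_const)

theorem Susp.continuous_sigma_uncurry :
    Continuous fun p : X × I => Susp.sigma p.1 p.2 :=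
  Path.continuous_uncurry_iff.2 (Susp.continuous_sigma (X := X))

instance [CompactSpace X] : CompactSpace (Susp X) :=
  inferInstanceAs (CompactSpace (Quotient (suspSetoid X)))

theorem Susp.isProperMap_mk [CompactSpace X] :
    IsProperMap (Susp.mk : X × I → Susp X) := by
  have hq : Topology.IsQuotientMap (Susp.mk : X × I → Susp X) := isQuotientMap_quotient_mk'
  have hc0 : IsClosed {p : X × I | p.2 = 0} := isClosed_eq continuous_snd continuous_const
  have hc1 : IsClosed {p : X × I | p.2 = 1} := isClosed_eq continuous_snd continuous_const
  have h01 : (0 : I) ≠ 1 := zero_ne_one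
  refine isProperMap_iff_isClosedMap_and_compact_fibers.2 ⟨Susp.continuous_mk, ?_, ?_⟩
  · intro C hC
    rw [← hq.isClosed_preimage]
    have key : Susp.mk ⁻¹' (Susp.mk '' C) =
        C ∪ {p : X × I | p.2 = 0 ∧ ∃ q ∈ C, q.2 = 0} ∪
          {p : X × I | p.2 = 1 ∧ ∃ q ∈ C, q.2 = 1} := by
      ext p
      simp only [Set.mem_preimage, Set.mem_image, Susp.mk_eq_mk_iff, Set.mem_union,
        Set.mem_ofPred_eq]
      grind
    rw [key]
    exact (hC.union (hc0.and isClosed_const)).union (hc1.and isClosed_const)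
  · intro y
    obtain ⟨p, rfl⟩ := Susp.surjective_mk y
    have key : Susp.mk ⁻¹' {Susp.mk p} =
        {p} ∪ ({q : X × I | q.2 = 0 ∧ p.2 = 0} ∪ {q : X × I | q.2 = 1 ∧ p.2 = 1}) := by
      ext q
      simp only [Set.mem_preimage, Set.mem_singleton_iff, Susp.mk_eq_mk_iff, Set.mem_union,
        Set.mem_ofPred_eq]
    rw [key]
    exact isCompact_singleton.union
      ((hc0.and isClosed_const).isCompact.union (hc1.and isClosed_const).isCompact)

/-- The lift of a map `f : X × Y → Z` to `Susp X × Y → Susp Z` that sends both poles to the north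
pole and `(merid x t, y)` to `σ (f (x, y)) t`. -/
noncomputable def hat [CompactSpace X] (f : C(X × Y, Z)) : C(Susp X × Y, Susp Z) where
  toFun p := Quotient.lift (s := suspSetoid X)
    (fun q : X × I => Susp.sigma (f (q.1, p.2)) q.2)
    (by
      rintro ⟨x, s⟩ ⟨x', s'⟩ (h | ⟨h, k⟩ | ⟨h, k⟩)
      · rw [h]
      · obtain rfl : s = 0 := h
        obtain rfl : s' = 0 := k
        exact (Path.source _).trans (Path.source _).symm
      · obtain rfl : s = 1 := h
        obtain rfl : s' = 1 := k
        exact (Path.target _).trans (Path.target _).symm) p.1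
  continuous_toFun := by
    have hp : IsProperMap (Prod.map (Susp.mk : X × I → Susp X) (id : Y → Y)) :=
      Susp.isProperMap_mk.prodMap isProperMap_id
    have hq : Topology.IsQuotientMap (Prod.map (Susp.mk : X × I → Susp X) (id : Y → Y)) :=
      hp.isClosedMap.isQuotientMap hp.continuous
        (Susp.surjective_mk.prodMap Function.surjective_id)
    rw [hq.continuous_iff]
    have h : Continuous fun r : (X × I) × Y => Susp.sigma (f (r.1.1, r.2)) r.1.2 :=
      Susp.continuous_sigma_uncurry.comp
        (g := fun p : Z × I => Susp.sigma p.1 p.2)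
        (f := fun r : (X × I) × Y => (f (r.1.1, r.2), r.1.2)) (by fun_prop)
    exact h

/-- The sum of two pointed maps out of a suspension: both poles go to the base point, and
`merid x` goes to the loop `f (σ x) · g (σ x)`. -/
noncomputable def addSusp (f g : Susp X →⋆ Y) : Susp X →⋆ Y where
  val :=
    { toFun := Quotient.lift (s := suspSetoid X)
        (fun q : X × I =>
          (f.loopMap (Susp.sigma q.1)).trans (g.loopMap (Susp.sigma q.1)) q.2)
        (by
          rintro ⟨x, s⟩ ⟨x', s'⟩ (h | ⟨h, k⟩ | ⟨h, k⟩)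
          · rw [h]
          · obtain rfl : s = 0 := h
            obtain rfl : s' = 0 := k
            exact (Path.source _).trans (Path.source _).symm
          · obtain rfl : s = 1 := h
            obtain rfl : s' = 1 := k
            exact (Path.target _).trans (Path.target _).symm)
      continuous_toFun := by
        refine Continuous.quotient_lift ?_ _
        have h : Continuous fun x : X =>
            (f.loopMap (Susp.sigma x)).trans (g.loopMap (Susp.sigma x)) :=
          Path.continuous_trans.comp
            (((continuous_loopMap f).comp Susp.continuous_sigma).prodMk
              ((continuous_loopMap g).comp Susp.continuous_sigma))
        exact Path.continuous_uncurry_iff.2 h }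
  property := ((f.loopMap (Susp.sigma X.pt)).trans (g.loopMap (Susp.sigma X.pt))).source

end Suspension

section Join

/-- The gluing relation on `X × Y × [0,1]` that identifies `(x, y, 0)` with `(x, y', 0)` and
`(x, y, 1)` with `(x', y, 1)`. -/
def joinSetoid (X : Type u) (Y : Type v) : Setoid (X × Y × I) where
  r p q := p = q ∨ (p.1 = q.1 ∧ p.2.2 = 0 ∧ q.2.2 = 0) ∨
    (p.2.1 = q.2.1 ∧ p.2.2 = 1 ∧ q.2.2 = 1)
  iseqv :=
    { refl := fun _ => Or.inl rfl
      symm := by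
        rintro p q (h | ⟨h, k, l⟩ | ⟨h, k, l⟩)
        · exact Or.inl h.symm
        · exact Or.inr (Or.inl ⟨h.symm, l, k⟩)
        · exact Or.inr (Or.inr ⟨h.symm, l, k⟩)
      trans := by
        have h01 : (0 : I) ≠ 1 := zero_ne_one
        rintro p q r hpq hqr
        grind }

/-- The join `X * Y` of two pointed spaces, with the quotient topology, pointed by `inl ⋆`. -/
def Join (X : PointedSpace.{u}) (Y : PointedSpace.{v}) : PointedSpace.{max u v} where
  carrier := Quotient (joinSetoid X Y)
  pt := Quotient.mk (joinSetoid X Y) (X.pt, Y.pt, 0)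

variable {X : PointedSpace.{u}} {Y : PointedSpace.{v}} {Z : PointedSpace.{w}}

def Join.mk (p : X × Y × I) : Join X Y := Quotient.mk (joinSetoid X Y) p

def Join.inl (x : X) : Join X Y := Join.mk (x, Y.pt, 0)

def Join.inr (y : Y) : Join X Y := Join.mk (X.pt, y, 1)

theorem Join.continuous_mk : Continuous (Join.mk : X × Y × I → Join X Y) :=
  continuous_quotient_mk'

theorem Join.mk_eq_mk_iff {p q : X × Y × I} :
    Join.mk p = Join.mk q ↔ p = q ∨ (p.1 = q.1 ∧ p.2.2 = 0 ∧ q.2.2 = 0) ∨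
      (p.2.1 = q.2.1 ∧ p.2.2 = 1 ∧ q.2.2 = 1) :=
  Quotient.eq (r := joinSetoid X Y)

/-- The segment from `inl x` to `inr y`. -/
def Join.push (x : X) (y : Y) : Path (Join.inl x : Join X Y) (Join.inr y) where
  toFun t := Join.mk (x, y, t)
  continuous_toFun := Join.continuous_mk.comp (by fun_prop)
  source' := Join.mk_eq_mk_iff.2 (Or.inr (Or.inl ⟨rfl, rfl, rfl⟩))
  target' := Join.mk_eq_mk_iff.2 (Or.inr (Or.inr ⟨rfl, rfl, rfl⟩))

/-- The loop `ℓ (x, y) = push (⋆, ⋆) · push (x, ⋆)⁻¹ · push (x, y) · push (⋆, y)⁻¹` in `X * Y`. -/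
noncomputable def Join.ell (x : X) (y : Y) : Path (Join X Y).pt (Join X Y).pt :=
  (((Join.push X.pt Y.pt).trans (Join.push x Y.pt).symm).trans (Join.push x y)).trans
    (Join.push X.pt y).symm

theorem Join.continuous_ell : Continuous fun p : X × Y => Join.ell p.1 p.2 := by
  have hp : Continuous ↿fun p : X × Y => (Join.push p.1 p.2 : Path _ (Join.inr p.2)) := by
    have h : Continuous fun r : (X × Y) × I => (r.1.1, r.1.2, r.2) := by fun_prop
    exact Join.continuous_mk.comp h
  have hp₀ : Continuous ↿fun _ : X × Y => (Join.push X.pt Y.pt : Path _ (Join.inr Y.pt)) := by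
    have h : Continuous fun r : (X × Y) × I => (X.pt, Y.pt, r.2) := by fun_prop
    exact Join.continuous_mk.comp h
  have hp₁ : Continuous ↿fun p : X × Y => (Join.push p.1 Y.pt : Path _ (Join.inr Y.pt)) := by
    have h : Continuous fun r : (X × Y) × I => (r.1.1, Y.pt, r.2) := by fun_prop
    exact Join.continuous_mk.comp h
  have hp₂ : Continuous ↿fun p : X × Y => (Join.push X.pt p.2 : Path _ (Join.inr p.2)) := by
    have h : Continuous fun r : (X × Y) × I => (X.pt, r.1.2, r.2) := by fun_prop
    exact Join.continuous_mk.comp h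
  rw [← Path.continuous_uncurry_iff]
  exact Path.trans_continuous_family _
    (Path.trans_continuous_family _
      (Path.trans_continuous_family _ hp₀ _ (Path.symm_continuous_family _ hp₁)) _ hp) _
    (Path.symm_continuous_family _ hp₂)

/-- The sum `f +* g` of two pointed maps out of a join: `inl x` and `inr y` go to the base point,
and `push (x, y)` goes to the loop `f (ℓ (x, y)) · g (ℓ (x, y))`. -/
noncomputable def addJoin (f g : Join X Y →⋆ Z) : Join X Y →⋆ Z where
  val :=
    { toFun := Quotient.lift (s := joinSetoid X Y)
        (fun q : X × Y × I =>
          (f.loopMap (Join.ell q.1 q.2.1)).trans (g.loopMap (Join.ell q.1 q.2.1)) q.2.2)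
        (by
          rintro ⟨x, y, s⟩ ⟨x', y', s'⟩ (h | ⟨_, h, k⟩ | ⟨_, h, k⟩)
          · rw [h]
          · obtain rfl : s = 0 := h
            obtain rfl : s' = 0 := k
            exact (Path.source _).trans (Path.source _).symm
          · obtain rfl : s = 1 := h
            obtain rfl : s' = 1 := k
            exact (Path.target _).trans (Path.target _).symm)
      continuous_toFun := by
        refine Continuous.quotient_lift ?_ _
        have h : Continuous fun p : X × Y =>
            (f.loopMap (Join.ell p.1 p.2)).trans (g.loopMap (Join.ell p.1 p.2)) :=
          Path.continuous_trans.comp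
            (((continuous_loopMap f).comp Join.continuous_ell).prodMk
              ((continuous_loopMap g).comp Join.continuous_ell))
        have h' := Path.continuous_uncurry_iff.2 h
        exact h'.comp (g := fun r : (X × Y) × I =>
            (f.loopMap (Join.ell r.1.1 r.1.2)).trans (g.loopMap (Join.ell r.1.1 r.1.2)) r.2)
          (f := fun q : X × Y × I => ((q.1, q.2.1), q.2.2)) (by fun_prop) }
  property := ((f.loopMap (Join.ell X.pt Y.pt)).trans (g.loopMap (Join.ell X.pt Y.pt))).source

/-- The map `X * Y → Susp Z` induced by a map `c : X × Y → Z`: it sends `inl x` to the north pole,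
`inr y` to the south pole and `push (x, y)` to `merid (c (x, y))`. -/
def joinToSusp (c : C(X × Y, Z)) : Join X Y →⋆ Susp Z where
  val :=
    { toFun := Quotient.lift (s := joinSetoid X Y)
        (fun q : X × Y × I => Susp.merid (c (q.1, q.2.1)) q.2.2)
        (by
          rintro ⟨x, y, s⟩ ⟨x', y', s'⟩ (h | ⟨_, h, k⟩ | ⟨_, h, k⟩)
          · rw [h]
          · obtain rfl : s = 0 := h
            obtain rfl : s' = 0 := k
            exact (Path.source _).trans (Path.source _).symm
          · obtain rfl : s = 1 := h
            obtain rfl : s' = 1 := k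
            exact (Path.target _).trans (Path.target _).symm)
      continuous_toFun := by
        refine Continuous.quotient_lift ?_ _
        have h := Path.continuous_uncurry_iff.2 (Susp.continuous_merid (X := Z))
        exact h.comp (g := fun p : Z × I => Susp.merid p.1 p.2)
          (f := fun q : X × Y × I => (c (q.1, q.2.1), q.2.2)) (by fun_prop) }
  property := (Susp.merid (c (X.pt, Y.pt))).source

/-- The variant of `joinToSusp` with loops in place of meridians: it sends all `inl x` and `inr y`
to the north pole and `push (x, y)` to `σ (c (x, y))`. -/
noncomputable def joinToSuspLoop (c : C(X × Y, Z)) : Join X Y →⋆ Susp Z where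
  val :=
    { toFun := Quotient.lift (s := joinSetoid X Y)
        (fun q : X × Y × I => Susp.sigma (c (q.1, q.2.1)) q.2.2)
        (by
          rintro ⟨x, y, s⟩ ⟨x', y', s'⟩ (h | ⟨_, h, k⟩ | ⟨_, h, k⟩)
          · rw [h]
          · obtain rfl : s = 0 := h
            obtain rfl : s' = 0 := k
            exact (Path.source _).trans (Path.source _).symm
          · obtain rfl : s = 1 := h
            obtain rfl : s' = 1 := k
            exact (Path.target _).trans (Path.target _).symm)
      continuous_toFun := by
        refine Continuous.quotient_lift ?_ _
        exact Susp.continuous_sigma_uncurry.comp (g := fun p : Z × I => Susp.sigma p.1 p.2)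
          (f := fun q : X × Y × I => (c (q.1, q.2.1), q.2.2)) (by fun_prop) }
  property := (Susp.sigma (c (X.pt, Y.pt))).source

end Join

section Spheres

/-- The spheres as iterated suspensions of the two-point space: `S⁰ = {true, false}`, pointed by
`true`, and `Sⁿ⁺¹ = Susp Sⁿ`. -/
def Sphere : ℕ → PointedSpace.{0}
  | 0 => ⟨Bool, true⟩
  | n + 1 => Susp (Sphere n)

instance compactSpace_sphere : ∀ n, CompactSpace (Sphere n)
  | 0 => inferInstanceAs (CompactSpace Bool)
  | n + 1 => @instCompactSpaceCarrierSusp (Sphere n) (compactSpace_sphere n)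

/-- The multiplication `S⁰ × Sᵐ → Sᵐ`: `false ⌣ y = y` and `true ⌣ y = ⋆`. -/
def cupZero (m : ℕ) : C(Sphere 0 × Sphere m, Sphere m) where
  toFun p := Bool.rec p.2 (Sphere m).pt (p.1 : Bool)
  continuous_toFun := by
    have h : Continuous fun p : Bool × Sphere m =>
        (Bool.rec p.2 (Sphere m).pt p.1 : Sphere m) := by
      refine continuous_prod_of_discrete_left.2 ?_
      rintro (_ | _)
      · exact continuous_id
      · exact continuous_const
    exact h

/-- The multiplication `⌣ : Sⁿ × Sᵐ → Sⁿ⁺ᵐ`, by recursion on `n`. The dimension of the target is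
written `m + n` so that `m + (n + 1)` is by definition the successor of `m + n`. -/
noncomputable def cup : (n m : ℕ) → C(Sphere n × Sphere m, Sphere (m + n))
  | 0, m => cupZero m
  | n + 1, m => hat (X := Sphere n) (cup n m)

/-- The map `F : Sⁿ * Sᵐ → Susp Sⁿ⁺ᵐ = Sⁿ⁺ᵐ⁺¹` with `F (inl x)` the north pole, `F (inr y)` the
south pole and `F (push (x, y) t) = merid (x ⌣ y) t`. -/
noncomputable def sphereJoinMap (n m : ℕ) : Join (Sphere n) (Sphere m) →⋆ Sphere (m + n + 1) :=
  joinToSusp (cup n m)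

/-- The map `Sⁿ * Sᵐ → Sⁿ⁺ᵐ⁺¹` that sends `inl x` and `inr y` to the north pole and `push (x, y)`
to `σ (x ⌣ y)`. -/
noncomputable def sphereJoinMapLoop (n m : ℕ) : Join (Sphere n) (Sphere m) →⋆ Sphere (m + n + 1) :=
  joinToSuspLoop (cup n m)

/-- `π_k(A)`: pointed homotopy classes of pointed maps `Sᵏ → A`. -/
def HtpyGroup (k : ℕ) (A : PointedSpace.{u}) : Type u :=
  HtpyClasses (Sphere k) A

/-- `π*_{n+m+1}(A)`: pointed homotopy classes of pointed maps `Sⁿ * Sᵐ → A`. -/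
def HtpyGroupStar (n m : ℕ) (A : PointedSpace.{u}) : Type u :=
  HtpyClasses (Join (Sphere n) (Sphere m)) A

/-- The class in `π_k(A)` of a pointed map. -/
def HtpyGroup.mk {k : ℕ} {A : PointedSpace.{u}} (f : Sphere k →⋆ A) : HtpyGroup k A := cls f

/-- The class in `π*_{n+m+1}(A)` of a pointed map. -/
def HtpyGroupStar.mk {n m : ℕ} {A : PointedSpace.{u}} (f : Join (Sphere n) (Sphere m) →⋆ A) :
    HtpyGroupStar n m A := cls f

/-- The addition of pointed maps `Sᵏ⁺¹ = Susp Sᵏ → A`. -/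
noncomputable def addSphere {k : ℕ} {A : PointedSpace.{u}} (f g : Sphere (k + 1) →⋆ A) :
    Sphere (k + 1) →⋆ A :=
  addSusp (X := Sphere k) f g

end Spheres

end JoinHomotopy

open JoinHomotopy

/-! A map out of a suspension or a join is a path in a mapping space `C(W, B)`, with `W = X` or `W =
X × Y`, whose ends respect the gluing. The base point lies over `t = 0`, so a homotopy of such paths
relative to their ends is a pointed homotopy. Most of the argument is therefore a calculation with
paths and loops in mapping spaces.

Restriction along σ embeds the pointed classes of maps `Susp X → A` into the fundamental group of
`C(X, A)` at the constant map and turns `addSusp` into concatenation (`sigmaLoop_homotopic_iff`,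
`sigmaLoop_addSusp`). This gives the group structure on the suspension side. The map `F` sends the
family ℓ(x, y) to one homotopic to σ(x ⌣ y), since ⋆ ⌣ y = ⋆ and x ⌣ ⋆ is null homotopic in x
(`joinToSusp_ell_homotopic`); so `F` is compatible with the two sums.

Bijectivity rests on ⌣ behaving like the projection onto a smash product, up to homotopy
(`IsSmashLike`). This is proved by induction on n; the step `IsSmashLike.hat` applies the hypothesis
to the loop space of the target, which is why the target is quantified over. Applied to loops in
`A`, it shows that f ∘ σ is determined by its pullback along ⌣, whence injectivity. For
surjectivity, f ∘ ℓ is null homotopic on both axes, so it comes from a family over the sphere, and f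
is pointed homotopic to the map that f ∘ ℓ defines (`homotopicRel_ell`). This last fact uses that
spheres are well pointed: the path along which inl ⋆ would have to slide is only a null homotopic
loop, and it has to be shortened to a constant one.

The group structure on the join side is transported along the bijection and then identified with
`addJoin`. -/

namespace JoinHomotopy

/-! ### Singular squares -/

section Squares

variable {E : Type*} [TopologicalSpace E]

theorem contractibleSpace_unitInterval : ContractibleSpace I :=
  (convex_Icc (0 : ℝ) 1).contractibleSpace ⟨0, by simp⟩

/-- The two ways around the boundary of a singular square are homotopic. -/
theorem square_homotopic (Q : C(I × I, E)) {x y z v : E} {μ : Path x y} {β : Path y v}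
    {α : Path x z} {μ' : Path z v} (hμ : ∀ t, μ t = Q (0, t)) (hβ : ∀ s, β s = Q (s, 1))
    (hα : ∀ s, α s = Q (s, 0)) (hμ' : ∀ t, μ' t = Q (1, t)) :
    (μ.trans β).Homotopic (α.trans μ') := by
  have := contractibleSpace_unitInterval
  obtain rfl : x = Q (0, 0) := by rw [← hμ, μ.source]
  obtain rfl : y = Q (0, 1) := by rw [← hμ, μ.target]
  obtain rfl : z = Q (1, 0) := by rw [← hμ', μ'.source]
  obtain rfl : v = Q (1, 1) := by rw [← hμ', μ'.target]
  let ι : Path (0 : I) 1 := ⟨ContinuousMap.id I, rfl, rfl⟩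
  have h := (SimplyConnectedSpace.paths_homotopic
    (((Path.refl (0 : I)).prod ι).trans (ι.prod (Path.refl (1 : I))))
    ((ι.prod (Path.refl (0 : I))).trans ((Path.refl (1 : I)).prod ι))).map Q
  rw [Path.map_trans, Path.map_trans] at h
  convert! h using 2 <;> ext t
  · exact hμ t
  · exact hβ t
  · exact hα t
  · exact hμ' t

end Squares

/-! ### Homotopies as paths in mapping spaces -/

section Families

variable {W W' B B' : Type*} [TopologicalSpace W] [TopologicalSpace W'] [TopologicalSpace B]
  [TopologicalSpace B']

/-- The path in a mapping space given by a homotopy, with prescribed end points. -/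
def familyPath (F : C(W × I, B)) (a b : C(W, B)) (ha : ∀ w, F (w, 0) = a w)
    (hb : ∀ w, F (w, 1) = b w) : Path a b where
  toFun t := (F.comp ContinuousMap.prodSwap).curry t
  continuous_toFun := ContinuousMap.continuous _
  source' := ContinuousMap.ext ha
  target' := ContinuousMap.ext hb

/-- Precomposition of a path in a mapping space, with prescribed end points. -/
def pull {a b : C(W, B)} (μ : Path a b) (φ : C(W', W)) {a' b' : C(W', B)}
    (ha : ∀ w, a' w = a (φ w)) (hb : ∀ w, b' w = b (φ w)) : Path a' b' where
  toFun t := (μ t).comp φ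
  continuous_toFun := (ContinuousMap.continuous_precomp φ).comp μ.continuous
  source' := by ext w; simp [ha]
  target' := by ext w; simp [hb]

/-- Postcomposition of a path in a mapping space, with prescribed end points. -/
def push {a b : C(W, B)} (f : C(B, B')) (μ : Path a b) {a' b' : C(W, B')}
    (ha : ∀ w, a' w = f (a w)) (hb : ∀ w, b' w = f (b w)) : Path a' b' where
  toFun t := f.comp (μ t)
  continuous_toFun := (ContinuousMap.continuous_postcomp f).comp μ.continuous
  source' := by ext w; simp [ha]
  target' := by ext w; simp [hb]

section

variable {a b c : C(W, B)} (μ : Path a b) (ν : Path b c)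

@[simp]
theorem pull_apply (φ : C(W', W)) {a' b' : C(W', B)} (ha : ∀ w, a' w = a (φ w))
    (hb : ∀ w, b' w = b (φ w)) (t : I) (w : W') : pull μ φ ha hb t w = μ t (φ w) := rfl

theorem path_ext₂ {μ ν : Path a b} (h : ∀ t w, μ t w = ν t w) : μ = ν := by
  ext t w
  exact h t w

theorem pull_trans (φ : C(W', W)) {a' b' c' : C(W', B)} (ha : ∀ w, a' w = a (φ w))
    (hb : ∀ w, b' w = b (φ w)) (hc : ∀ w, c' w = c (φ w)) :
    pull (μ.trans ν) φ ha hc = (pull μ φ ha hb).trans (pull ν φ hb hc) :=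
  path_ext₂ fun t w => by
    simp only [pull_apply, Path.trans_apply]
    split_ifs <;> rfl

theorem homotopic_pull {μ ν : Path a b} (h : μ.Homotopic ν) (φ : C(W', W)) {a' b' : C(W', B)}
    (ha : ∀ w, a' w = a (φ w)) (hb : ∀ w, b' w = b (φ w)) :
    (pull μ φ ha hb).Homotopic (pull ν φ ha hb) := by
  obtain rfl : a' = a.comp φ := ContinuousMap.ext ha
  obtain rfl : b' = b.comp φ := ContinuousMap.ext hb
  exact h.map ⟨_, ContinuousMap.continuous_precomp φ⟩

theorem homotopic_push {μ ν : Path a b} (h : μ.Homotopic ν) (f : C(B, B')) {a' b' : C(W, B')}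
    (ha : ∀ w, a' w = f (a w)) (hb : ∀ w, b' w = f (b w)) :
    (push f μ ha hb).Homotopic (push f ν ha hb) := by
  obtain rfl : a' = f.comp a := ContinuousMap.ext ha
  obtain rfl : b' = f.comp b := ContinuousMap.ext hb
  exact h.map ⟨_, ContinuousMap.continuous_postcomp f⟩

/-- Currying in this direction is continuous for every `W`; the converse
`exists_family_of_homotopic` needs `W` locally compact. -/
theorem homotopic_of_family {μ ν : Path a b} (G : C((W × I) × I, B))
    (h0 : ∀ w t, G ((w, t), 0) = μ t w) (h1 : ∀ w t, G ((w, t), 1) = ν t w)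
    (ha : ∀ w s, G ((w, 0), s) = a w) (hb : ∀ w s, G ((w, 1), s) = b w) : μ.Homotopic ν := by
  let K : C(I × I, C(W, B)) :=
    (G.comp ⟨fun r : (I × I) × W => ((r.2, r.1.2), r.1.1), by fun_prop⟩).curry
  refine ⟨⟨⟨K, ?_, ?_⟩, ?_⟩⟩
  · exact fun t => ContinuousMap.ext fun w => h0 w t
  · exact fun t => ContinuousMap.ext fun w => h1 w t
  · rintro s t (rfl | rfl)
    · exact ContinuousMap.ext fun w => (ha w s).trans (by simp)
    · exact ContinuousMap.ext fun w => (hb w s).trans (by simp)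

end

variable [LocallyCompactSpace W]

/-- The homotopy underlying a path in a mapping space. -/
def family {a b : C(W, B)} (μ : Path a b) : C(W × I, B) :=
  (ContinuousMap.uncurry ⟨μ, μ.continuous⟩).comp ContinuousMap.prodSwap

@[simp]
theorem family_apply {a b : C(W, B)} (μ : Path a b) (w : W) (t : I) :
    family μ (w, t) = μ t w := rfl

theorem exists_family_of_homotopic {a b : C(W, B)} {μ ν : Path a b} (h : μ.Homotopic ν) :
    ∃ G : C((W × I) × I, B), (∀ w t, G ((w, t), 0) = μ t w) ∧ (∀ w t, G ((w, t), 1) = ν t w) ∧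
      (∀ w s, G ((w, 0), s) = a w) ∧ ∀ w s, G ((w, 1), s) = b w := by
  obtain ⟨H⟩ := h
  refine ⟨(ContinuousMap.uncurry H.toContinuousMap).comp
    ⟨fun r : (W × I) × I => ((r.2, r.1.2), r.1.1), by fun_prop⟩, ?_, ?_, ?_, ?_⟩
  · intro w t; exact congrArg (fun f : C(W, B) => f w) (H.map_zero_left t)
  · intro w t; exact congrArg (fun f : C(W, B) => f w) (H.map_one_left t)
  · intro w s; exact congrArg (fun f : C(W, B) => f w) (H.source s)
  · intro w s; exact congrArg (fun f : C(W, B) => f w) (H.target s)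

variable {D : Type*} [TopologicalSpace D]

/-- Naturality of a homotopy along a path in a mapping space. -/
theorem homotopy_naturality {f f' : C(D, B)} (H : f.Homotopy f') {a b : C(W, D)} (m : Path a b)
    {a₀ b₀ a₁ b₁ : C(W, B)} {μ : Path a₀ b₀} {μ' : Path a₁ b₁} {α : Path a₀ a₁} {β : Path b₀ b₁}
    (hμ : ∀ t w, μ t w = f (m t w)) (hμ' : ∀ t w, μ' t w = f' (m t w))
    (hα : ∀ s w, α s w = H (s, a w)) (hβ : ∀ s w, β s w = H (s, b w)) :
    (μ.trans β).Homotopic (α.trans μ') := by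
  let K : C((I × I) × W, B) := H.toContinuousMap.comp
    ⟨fun r : (I × I) × W => (r.1.1, family m (r.2, r.1.2)), by fun_prop⟩
  refine square_homotopic K.curry ?_ ?_ ?_ ?_ <;> intro t <;> ext w
  · simp [K, hμ]
  · simp [K, hβ]
  · simp [K, hα]
  · simp [K, hμ']

/-- A null homotopic map identifies paths with the same end points. -/
theorem homotopic_of_nullhomotopic {f : C(D, B)} {x : B}
    (hf : f.Homotopic (ContinuousMap.const D x)) {a b : C(W, D)} (m n : Path a b)
    {a₀ b₀ : C(W, B)} {μ ν : Path a₀ b₀} (hμ : ∀ t w, μ t w = f (m t w))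
    (hν : ∀ t w, ν t w = f (n t w)) : μ.Homotopic ν := by
  obtain ⟨H⟩ := hf
  have h0 : ∀ w, a₀ w = f (a w) := fun w => by
    have := hμ 0 w
    simpa using this
  have h1 : ∀ w, b₀ w = f (b w) := fun w => by
    have := hμ 1 w
    simpa using this
  let α : Path a₀ (ContinuousMap.const W x) :=
    familyPath (H.toContinuousMap.comp ⟨fun r : W × I => (r.2, a r.1), by fun_prop⟩) _ _
      (fun w => by simp [h0]) (fun w => by simp)
  let β : Path b₀ (ContinuousMap.const W x) :=
    familyPath (H.toContinuousMap.comp ⟨fun r : W × I => (r.2, b r.1), by fun_prop⟩) _ _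
      (fun w => by simp [h1]) (fun w => by simp)
  -- The null homotopy contracts the image of any path `m` from `a` to `b`, so μ · β is homotopic to
  -- α, which depends only on the end points. Cancelling β compares the two paths.
  have key : ∀ {m : Path a b} {μ : Path a₀ b₀}, (∀ t w, μ t w = f (m t w)) →
      (μ.trans β).Homotopic (α.trans (Path.refl _)) := fun {m μ} h =>
    homotopy_naturality H m h (fun _ _ => rfl) (fun _ _ => rfl) (fun _ _ => rfl)
  have h := (key hμ).trans (key hν).symm
  rw [← Path.Homotopic.Quotient.eq, Path.Homotopic.Quotient.mk_trans,
    Path.Homotopic.Quotient.mk_trans] at h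
  have h' := congrArg (fun z => z.trans (Path.Homotopic.Quotient.mk β).symm) h
  simp only [Path.Homotopic.Quotient.trans_assoc, Path.Homotopic.Quotient.trans_symm,
    Path.Homotopic.Quotient.trans_refl] at h'
  exact Path.Homotopic.Quotient.exact h'

/-- Homotopic maps pull a path between constant maps back to homotopic paths. -/
theorem homotopic_pull_of_homotopic {φ ψ : C(W', W)} (h : φ.Homotopic ψ) {x y : B} {a b : C(W, B)}
    (m : Path a b) (ha : ∀ w, a w = x) (hb : ∀ w, b w = y)
    {μ ν : Path (ContinuousMap.const W' x) (ContinuousMap.const W' y)}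
    (hμ : ∀ t w, μ t w = m t (φ w)) (hν : ∀ t w, ν t w = m t (ψ w)) : μ.Homotopic ν := by
  obtain ⟨H⟩ := h
  refine homotopic_of_family ((family m).comp
    ⟨fun r : (W' × I) × I => (H (r.2, r.1.1), r.1.2), by fun_prop⟩) ?_ ?_ ?_ ?_
  · intro w t; simp [hμ]
  · intro w t; simp [hν]
  · intro w s; simp [ha]
  · intro w s; simp [hb]

end Families

/-! ### Double mapping cylinders -/

section Cylinders

variable {W U V D B : Type*} [TopologicalSpace W] [TopologicalSpace D] [TopologicalSpace B]

/-- A presentation of a space `D` as the double mapping cylinder of `p` and `q`. -/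
structure IsCylinder (mk : C(W × I, D)) (p : W → U) (q : W → V) : Prop where
  isQuotientMap : Topology.IsQuotientMap mk
  eq_zero : ∀ {w w'}, p w = p w' → mk (w, 0) = mk (w', 0)
  eq_one : ∀ {w w'}, q w = q w' → mk (w, 1) = mk (w', 1)
  cases_of_eq : ∀ {w w' t t'}, mk (w, t) = mk (w', t') → (w = w' ∧ t = t') ∨
    (p w = p w' ∧ t = 0 ∧ t' = 0) ∨ (q w = q w' ∧ t = 1 ∧ t' = 1)

namespace IsCylinder

variable {mk : C(W × I, D)} {p : W → U} {q : W → V} (h : IsCylinder mk p q)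

include h

theorem exists_lift (F : C(W × I, B)) (h0 : ∀ {w w'}, p w = p w' → F (w, 0) = F (w', 0))
    (h1 : ∀ {w w'}, q w = q w' → F (w, 1) = F (w', 1)) : ∃ f : C(D, B), ∀ r, f (mk r) = F r := by
  have hF : Function.FactorsThrough F mk := by
    rintro ⟨w, t⟩ ⟨w', t'⟩ hr
    rcases h.cases_of_eq hr with ⟨rfl, rfl⟩ | ⟨hp, rfl, rfl⟩ | ⟨hq, rfl, rfl⟩
    exacts [rfl, h0 hp, h1 hq]
  refine ⟨h.isQuotientMap.lift F hF, fun r => ?_⟩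
  exact congrArg (fun g : C(W × I, B) => g r) (h.isQuotientMap.lift_comp F hF)

theorem homotopicRel {f f' : C(D, B)} (G : C((W × I) × I, B)) {S : Set D}
    (h0 : ∀ {w w'} s, p w = p w' → G ((w, 0), s) = G ((w', 0), s))
    (h1 : ∀ {w w'} s, q w = q w' → G ((w, 1), s) = G ((w', 1), s))
    (hf : ∀ r, G (r, 0) = f (mk r)) (hf' : ∀ r, G (r, 1) = f' (mk r))
    (hS : ∀ d ∈ S, ∃ r, mk r = d ∧ ∀ s, G (r, s) = f d) : f.HomotopicRel f' S := by
  have hG : ∀ r r' s, mk r = mk r' → G (r, s) = G (r', s) := by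
    rintro ⟨w, t⟩ ⟨w', t'⟩ s hr
    rcases h.cases_of_eq hr with ⟨rfl, rfl⟩ | ⟨hp, rfl, rfl⟩ | ⟨hq, rfl, rfl⟩
    exacts [rfl, h0 s hp, h1 s hq]
  let K : I × D → B := fun z => G (Function.surjInv h.isQuotientMap.surjective z.2, z.1)
  have hK : ∀ r s, K (s, mk r) = G (r, s) := fun r s =>
    hG _ _ _ (Function.surjInv_eq h.isQuotientMap.surjective _)
  have hc : Continuous K := by
    -- The product of a quotient map with the locally compact interval is again a quotient map.
    refine h.isQuotientMap.continuous_lift_prod_right ?_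
    simp only [hK]
    fun_prop
  refine ⟨⟨⟨⟨K, hc⟩, ?_, ?_⟩, ?_⟩⟩
  · intro d
    obtain ⟨r, rfl⟩ := h.isQuotientMap.surjective d
    exact (hK r 0).trans (hf r)
  · intro d
    obtain ⟨r, rfl⟩ := h.isQuotientMap.surjective d
    exact (hK r 1).trans (hf' r)
  · intro s d hd
    obtain ⟨r, rfl, hr⟩ := hS d hd
    exact (hK r s).trans (hr s)

variable [LocallyCompactSpace W] {a b : C(W, B)}

theorem exists_lift_path (μ : Path a b) (ha : ∀ {w w'}, p w = p w' → a w = a w')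
    (hb : ∀ {w w'}, q w = q w' → b w = b w') :
    ∃ f : C(D, B), ∀ t w, f (mk (w, t)) = μ t w := by
  obtain ⟨f, hf⟩ := h.exists_lift (family μ) (fun hp => by simpa using ha hp)
    (fun hq => by simpa using hb hq)
  exact ⟨f, fun t w => hf (w, t)⟩

/-- A homotopy of paths fixes both ends, so it descends to the cylinder and is constant on all
points over `t = 0`; the base points of suspensions and joins are such points. -/
theorem homotopicRel_of_path_homotopic {f f' : C(D, B)} {μ μ' : Path a b} (hμ : μ.Homotopic μ')
    (hf : ∀ t w, f (mk (w, t)) = μ t w) (hf' : ∀ t w, f' (mk (w, t)) = μ' t w) {S : Set D}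
    (hS : ∀ d ∈ S, ∃ w, mk (w, 0) = d) : f.HomotopicRel f' S := by
  obtain ⟨G, h0, h1, ha, hb⟩ := exists_family_of_homotopic hμ
  have ha' : ∀ w, a w = f (mk (w, 0)) := fun w => by simp [hf]
  have hb' : ∀ w, b w = f (mk (w, 1)) := fun w => by simp [hf]
  refine h.homotopicRel G ?_ ?_ ?_ ?_ ?_
  · intro w w' s hp
    rw [ha, ha, ha', ha', h.eq_zero hp]
  · intro w w' s hq
    rw [hb, hb, hb', hb', h.eq_one hq]
  · rintro ⟨w, t⟩; rw [h0, hf]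
  · rintro ⟨w, t⟩; rw [h1, hf']
  · intro d hd
    obtain ⟨w, rfl⟩ := hS d hd
    exact ⟨(w, 0), rfl, fun s => by rw [ha, ha']⟩

/-- Moving the image of the target end along `β`. -/
theorem homotopicRel_of_trans {f f' : C(D, B)} {b' : C(W, B)} {μ : Path a b} (β : Path b b')
    (hf : ∀ t w, f (mk (w, t)) = μ t w) (hf' : ∀ t w, f' (mk (w, t)) = μ.trans β t w)
    (hβ : ∀ {w w'} t, q w = q w' → β t w = β t w') {S : Set D}
    (hS : ∀ d ∈ S, ∃ w, mk (w, 0) = d) : f.HomotopicRel f' S := by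
  have hmem : ∀ r : I × I, (1 + (r.2 : ℝ)) * r.1 / 2 ∈ I := fun r => by
    have h1 := r.2.2
    have h2 := r.1.2
    constructor
    · have := h1.1; have := h2.1; positivity
    · nlinarith [h1.1, h1.2, h2.1, h2.2]
  -- At time s the initial part of μ · β of length (1 + s)/2 is traversed: exactly μ for s = 0,
  -- everything for s = 1. The end always lies on β, whose values depend only on `q`.
  let φ : C(I × I, I) := ⟨fun r => ⟨(1 + (r.2 : ℝ)) * r.1 / 2, hmem r⟩, by fun_prop⟩
  have hφ0 : ∀ s, φ (0, s) = 0 := fun s => by ext; simp [φ]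
  refine h.homotopicRel ((family (μ.trans β)).comp
    ⟨fun r => (r.1.1, φ (r.1.2, r.2)), by fun_prop⟩) ?_ ?_ ?_ ?_ ?_
  · intro w w' s hp
    have : a w = a w' := by
      have h0 := hf 0 w; have h1 := hf 0 w'
      rw [h.eq_zero hp] at h0
      simpa using h0.symm.trans h1
    simpa [hφ0] using this
  · intro w w' s hq
    have : ∀ t, (1 : ℝ) / 2 ≤ t → (μ.trans β).extend t w = (μ.trans β).extend t w' := by
      intro t ht
      rcases le_total t 1 with ht1 | ht1
      · have hI : t ∈ I := ⟨by linarith, ht1⟩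
        rw [Path.extend_apply _ hI, Path.trans_apply]
        split_ifs with hc
        · obtain rfl : t = 1 / 2 := le_antisymm hc ht
          have h0 := hf 1 w; have h1 := hf 1 w'
          rw [h.eq_one hq] at h0
          simpa using h0.symm.trans h1
        · exact hβ _ hq
      · rw [Path.extend_of_one_le _ ht1]
        simpa using hβ 1 hq
    have := this (φ (1, s)) (by have := s.2.1; simp [φ]; linarith)
    simpa using this
  · rintro ⟨w, t⟩
    have : (φ (t, 0) : ℝ) ≤ 1 / 2 := by
      have := t.2.2; simp [φ]; linarith
    simp only [ContinuousMap.comp_apply, ContinuousMap.coe_mk, family_apply, Path.trans_apply,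
      this, dif_pos, hf]
    congr 2
    ext
    simp [φ]
    ring
  · rintro ⟨w, t⟩
    have : φ (t, 1) = t := by ext; simp [φ]; ring
    simp [this, hf']
  · intro d hd
    obtain ⟨w, rfl⟩ := hS d hd
    refine ⟨(w, 0), rfl, fun s => ?_⟩
    simp [hφ0, hf]

/-- Moving the image of the source end along `α`. -/
theorem homotopicRel_of_trans_left {f f' : C(D, B)} {a' : C(W, B)} {μ : Path a b} (α : Path a' a)
    (hf : ∀ t w, f (mk (w, t)) = μ t w) (hf' : ∀ t w, f' (mk (w, t)) = α.trans μ t w)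
    (hα : ∀ {w w'} t, p w = p w' → α t w = α t w') {S : Set D}
    (hS : ∀ d ∈ S, ∃ w, mk (w, 0) = d ∧ ∀ t, α t w = a w) : f.HomotopicRel f' S := by
  have hmem : ∀ r : I × I, 1 - (1 + (r.2 : ℝ)) * (1 - r.1) / 2 ∈ I := fun r => by
    have h1 := r.2.2
    have h2 := r.1.2
    constructor
    · nlinarith [h1.1, h1.2, h2.1, h2.2]
    · nlinarith [h1.1, h1.2, h2.1, h2.2, mul_nonneg h1.1 (sub_nonneg.2 h2.2)]
  -- The mirror image: at time s the final part of α · μ of length (1 + s)/2 is traversed, so the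
  -- start always lies on α.
  let φ : C(I × I, I) := ⟨fun r => ⟨1 - (1 + (r.2 : ℝ)) * (1 - r.1) / 2, hmem r⟩, by fun_prop⟩
  have hφ1 : ∀ s, φ (1, s) = 1 := fun s => by ext; simp [φ]
  have hle : ∀ t, t ≤ (1 : ℝ) / 2 → ∀ w, ∃ t' : I, (α.trans μ).extend t w = α t' w ∧
      ∀ w', (α.trans μ).extend t w' = α t' w' := by
    intro t ht w
    rcases le_total 0 t with ht0 | ht0
    · have hI : t ∈ I := ⟨ht0, by linarith⟩
      refine ⟨⟨2 * t, by constructor <;> linarith⟩, ?_⟩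
      have : ∀ w', (α.trans μ).extend t w' = α ⟨2 * t, by constructor <;> linarith⟩ w' := by
        intro w'
        rw [Path.extend_apply _ hI, Path.trans_apply, dif_pos ht]
      exact ⟨this w, this⟩
    · refine ⟨0, ?_⟩
      rw [Path.extend_of_le_zero _ ht0]
      simp
  refine h.homotopicRel ((family (α.trans μ)).comp
    ⟨fun r => (r.1.1, φ (r.1.2, r.2)), by fun_prop⟩) ?_ ?_ ?_ ?_ ?_
  · intro w w' s hp
    obtain ⟨t', h1, h2⟩ := hle (φ (0, s)) (by have := s.2.1; simp [φ]; linarith) w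
    have : (α.trans μ).extend (φ (0, s)) w = (α.trans μ).extend (φ (0, s)) w' := by
      rw [h1, h2, hα _ hp]
    simpa using this
  · intro w w' s hq
    have : b w = b w' := by
      have h0 := hf 1 w; have h1 := hf 1 w'
      rw [h.eq_one hq] at h0
      simpa using h0.symm.trans h1
    simpa [hφ1] using this
  · rintro ⟨w, t⟩
    rw [hf]
    simp only [ContinuousMap.comp_apply, ContinuousMap.coe_mk, family_apply, Path.trans_apply]
    split_ifs with hc
    · have ht0 : t = 0 := by
        have := t.2.1
        simp [φ] at hc
        exact Subtype.ext (le_antisymm (by simp; linarith) this)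
      subst ht0
      have : (φ (0, 0) : ℝ) = 1 / 2 := by simp [φ]; norm_num
      simp [this]
    · congr 2
      ext
      simp [φ]
      ring
  · rintro ⟨w, t⟩
    have : φ (t, 1) = t := by ext; simp [φ]; ring
    simp [this, hf']
  · intro d hd
    obtain ⟨w, rfl, hw⟩ := hS d hd
    refine ⟨(w, 0), rfl, fun s => ?_⟩
    obtain ⟨t', h1, -⟩ := hle (φ (0, s)) (by have := s.2.1; simp [φ]; linarith) w
    have : (α.trans μ).extend (φ (0, s)) w = f (mk (w, 0)) := by
      rw [h1, hw, hf, μ.source]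
    simpa using this

end IsCylinder

end Cylinders

/-! ### Suspensions as cylinders, and the family σ -/

section SuspensionCylinder

variable {X : PointedSpace.{u}} {Y : Type v} [TopologicalSpace Y]

/-- The quotient map `X × [0,1] → Susp X`. -/
def suspMk (X : PointedSpace.{u}) : C(X × I, Susp X) := ⟨Susp.mk, Susp.continuous_mk⟩

/-- The quotient map `(X × Y) × [0,1] → Susp X × Y`. -/
def suspProdMk (X : PointedSpace.{u}) (Y : Type v) [TopologicalSpace Y] :
    C((X × Y) × I, Susp X × Y) :=
  ⟨fun r => (Susp.mk (r.1.1, r.2), r.1.2),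
    (Susp.continuous_mk.comp (f := fun r : (X × Y) × I => (r.1.1, r.2)) (by fun_prop)).prodMk
      (by fun_prop)⟩

theorem isCylinder_susp : IsCylinder (suspMk X) (fun _ => ()) (fun _ => ()) where
  isQuotientMap := isQuotientMap_quotient_mk'
  eq_zero _ := Susp.mk_eq_mk_iff.2 (Or.inr (Or.inl ⟨rfl, rfl⟩))
  eq_one _ := Susp.mk_eq_mk_iff.2 (Or.inr (Or.inr ⟨rfl, rfl⟩))
  cases_of_eq h := by
    rcases Susp.mk_eq_mk_iff.1 h with h | h | h
    · exact Or.inl (Prod.ext_iff.1 h)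
    · exact Or.inr (Or.inl ⟨rfl, h⟩)
    · exact Or.inr (Or.inr ⟨rfl, h⟩)

/-- Compactness of `X` makes `Susp.mk` proper, so its product with the identity of an arbitrary `Y`
is closed, hence a quotient map. -/
theorem isCylinder_suspProd [CompactSpace X] :
    IsCylinder (suspProdMk X Y) Prod.snd Prod.snd where
  isQuotientMap := by
    have hp : IsProperMap (Prod.map (Susp.mk : X × I → Susp X) (id : Y → Y)) :=
      Susp.isProperMap_mk.prodMap isProperMap_id
    have hq : Topology.IsQuotientMap (Prod.map (Susp.mk : X × I → Susp X) (id : Y → Y)) :=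
      hp.isClosedMap.isQuotientMap hp.continuous
        (Susp.surjective_mk.prodMap Function.surjective_id)
    let e : (X × Y) × I ≃ₜ (X × I) × Y :=
      { toFun := fun r => ((r.1.1, r.2), r.1.2)
        invFun := fun r => ((r.1.1, r.2), r.1.2)
        left_inv := fun _ => rfl
        right_inv := fun _ => rfl
        continuous_toFun := by fun_prop
        continuous_invFun := by fun_prop }
    exact hq.comp e.isQuotientMap
  eq_zero h := Prod.ext (Susp.mk_eq_mk_iff.2 (Or.inr (Or.inl ⟨rfl, rfl⟩))) h
  eq_one h := Prod.ext (Susp.mk_eq_mk_iff.2 (Or.inr (Or.inr ⟨rfl, rfl⟩))) h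
  cases_of_eq {w w' t t'} h := by
    have h2 : w.2 = w'.2 := congrArg (fun z : Susp X × Y => z.2) h
    have h1 : (Susp.mk (w.1, t) : Susp X) = Susp.mk (w'.1, t') :=
      congrArg (fun z : Susp X × Y => z.1) h
    rcases Susp.mk_eq_mk_iff.1 h1 with h | h | h
    · exact Or.inl ⟨Prod.ext (Prod.ext_iff.1 h).1 h2, (Prod.ext_iff.1 h).2⟩
    · exact Or.inr (Or.inl ⟨h2, h⟩)
    · exact Or.inr (Or.inr ⟨h2, h⟩)

/-- Local compactness passes along a proper surjection: thicken the compact fibre to a compact set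
`L` inside the preimage of the neighbourhood. The image of `L` is a neighbourhood because the image
of the closed complement of its interior is closed. -/
theorem locallyCompactSpace_susp [CompactSpace X] [LocallyCompactSpace X] :
    LocallyCompactSpace (Susp X) := by
  refine ⟨fun y n hn => ?_⟩
  obtain ⟨U, hUn, hU, hy⟩ := mem_nhds_iff.1 hn
  have hp := Susp.isProperMap_mk (X := X)
  have hK : IsCompact (Susp.mk ⁻¹' {y} : Set (X × I)) := hp.isCompact_preimage isCompact_singleton
  obtain ⟨L, hL, hKL, hLU⟩ := exists_compact_between hK (hU.preimage hp.continuous)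
    (fun r (hr : Susp.mk r = y) => show Susp.mk r ∈ U from hr ▸ hy)
  refine ⟨Susp.mk '' L, ?_, (Set.image_subset_iff.2 hLU).trans hUn, hL.image hp.continuous⟩
  refine mem_nhds_iff.2 ⟨(Susp.mk '' (interior L)ᶜ)ᶜ, ?_,
    (hp.isClosedMap _ isOpen_interior.isClosed_compl).isOpen_compl, ?_⟩
  · intro z hz
    obtain ⟨r, rfl⟩ := Susp.surjective_mk z
    refine ⟨r, interior_subset (by_contra fun hr => hz ⟨r, hr, rfl⟩), rfl⟩
  · rintro ⟨r, hr, rfl⟩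
    exact hr (hKL rfl)

instance locallyCompactSpace_sphere : ∀ n, LocallyCompactSpace (Sphere n)
  | 0 => inferInstanceAs (LocallyCompactSpace Bool)
  | n + 1 =>
    haveI := locallyCompactSpace_sphere n
    locallyCompactSpace_susp (X := Sphere n)

/-- The meridians, as a path between constant maps. -/
def meridPath (X : PointedSpace.{u}) :
    Path (ContinuousMap.const X (Susp X).pt) (ContinuousMap.const X Susp.south) :=
  familyPath (suspMk X) _ _ (fun _ => (Susp.merid _).source) (fun _ => (Susp.merid _).target)

/-- The constant family at the meridian through the base point. -/
def meridPathBase (X : PointedSpace.{u}) :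
    Path (ContinuousMap.const X (Susp X).pt) (ContinuousMap.const X Susp.south) :=
  pull (meridPath X) (ContinuousMap.const X X.pt) (by simp) (by simp)

/-- The family of loops `σ`, as a loop of maps `X → Susp X`. -/
noncomputable def sigmaPath (X : PointedSpace.{u}) :
    Path (ContinuousMap.const X (Susp X).pt) (ContinuousMap.const X (Susp X).pt) :=
  (meridPath X).trans (meridPathBase X).symm

theorem sigmaPath_apply (t : I) (x : X) : sigmaPath X t x = Susp.sigma x t := by
  rw [sigmaPath, Path.trans_apply]
  refine Eq.trans ?_ (Path.trans_apply (Susp.merid x) (Susp.merid X.pt).symm t).symm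
  split_ifs <;> rfl

theorem sigma_base_homotopic {W : Type*} [TopologicalSpace W]
    {μ : Path (ContinuousMap.const W (Susp X).pt) (ContinuousMap.const W (Susp X).pt)}
    (h : ∀ t w, μ t w = Susp.sigma X.pt t) : μ.Homotopic (Path.refl _) := by
  let m : Path (ContinuousMap.const W (Susp X).pt) (ContinuousMap.const W Susp.south) :=
    pull (meridPath X) (ContinuousMap.const W X.pt) (by simp) (by simp)
  have key : μ = m.trans m.symm := path_ext₂ fun t w => by
    rw [h, ← sigmaPath_apply, sigmaPath, Path.trans_apply, Path.trans_apply]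
    split_ifs <;> rfl
  rw [key]
  exact Path.Homotopic.trans_symm _

end SuspensionCylinder

/-! ### Joins as cylinders, and the family ℓ -/

section JoinCylinder

variable {X : PointedSpace.{u}} {Y : PointedSpace.{v}}

/-- The quotient map `(X × Y) × [0,1] → X * Y`. -/
def joinMk (X : PointedSpace.{u}) (Y : PointedSpace.{v}) : C((X × Y) × I, Join X Y) :=
  ⟨fun r => Join.mk (r.1.1, r.1.2, r.2),
    Join.continuous_mk.comp (f := fun r : (X × Y) × I => (r.1.1, r.1.2, r.2)) (by fun_prop)⟩

theorem isCylinder_join : IsCylinder (joinMk X Y) Prod.fst Prod.snd where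
  isQuotientMap := by
    have hq : Topology.IsQuotientMap (Join.mk : X × Y × I → Join X Y) :=
      isQuotientMap_quotient_mk'
    exact hq.comp (Homeomorph.prodAssoc X Y I).isQuotientMap
  eq_zero h := Join.mk_eq_mk_iff.2 (Or.inr (Or.inl ⟨h, rfl, rfl⟩))
  eq_one h := Join.mk_eq_mk_iff.2 (Or.inr (Or.inr ⟨h, rfl, rfl⟩))
  cases_of_eq {w w' t t'} h := by
    rcases Join.mk_eq_mk_iff.1 h with h | h | h
    · simp only [Prod.mk.injEq] at h
      exact Or.inl ⟨Prod.ext h.1 h.2.1, h.2.2⟩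
    · exact Or.inr (Or.inl h)
    · exact Or.inr (Or.inr h)

theorem ell_eval (x : X) (y : Y) (t : I) : Join.ell x y t =
    (((((Join.push X.pt Y.pt).trans (Join.push x Y.pt).symm).trans (Join.push x y)).trans
      (Join.push X.pt y).symm : Path (Join.inl X.pt : Join X Y) (Join.inl X.pt))) t := rfl

/-- The family of loops `ℓ`, as a loop of maps `X × Y → X * Y`. -/
noncomputable def ellPath (X : PointedSpace.{u}) (Y : PointedSpace.{v}) :
    Path (ContinuousMap.const (X × Y) (Join X Y).pt) (ContinuousMap.const (X × Y) (Join X Y).pt) :=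
  familyPath ⟨fun r : (X × Y) × I => Join.ell r.1.1 r.1.2 r.2,
      Path.continuous_uncurry_iff.2 (Join.continuous_ell (X := X) (Y := Y))⟩ _ _
    (fun r => (Join.ell r.1 r.2).source) (fun r => (Join.ell r.1 r.2).target)

end JoinCylinder

/-! ### Loops of maps and maps into loop spaces -/

section LoopFamilies

variable {W B : Type*} [TopologicalSpace W] [TopologicalSpace B] {b : B}

/-- The path in a mapping space given by a family of loops. -/
def ofLoopFamily (q : C(W, Path b b)) : Path (ContinuousMap.const W b) (ContinuousMap.const W b) :=
  familyPath ⟨fun r => q r.1 r.2, Path.continuous_uncurry_iff.2 q.continuous⟩ _ _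
    (fun w => (q w).source) (fun w => (q w).target)

/-- The family of loops given by a path in a mapping space. -/
def toLoopFamily [LocallyCompactSpace W]
    (μ : Path (ContinuousMap.const W b) (ContinuousMap.const W b)) : C(W, Path b b) where
  toFun w :=
    { toFun := fun t => μ t w
      continuous_toFun := (family μ).continuous.comp (f := fun t : I => (w, t)) (by fun_prop)
      source' := by simp
      target' := by simp }
  continuous_toFun := by
    rw [← Path.continuous_uncurry_iff]
    exact (family μ).continuous

theorem path_homotopic_of_homotopic {q q' : C(W, Path b b)} (h : q.Homotopic q')
    {μ μ' : Path (ContinuousMap.const W b) (ContinuousMap.const W b)} (hμ : ∀ t w, μ t w = q w t)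
    (hμ' : ∀ t w, μ' t w = q' w t) : μ.Homotopic μ' := by
  obtain ⟨H⟩ := h
  have hc : Continuous fun r : (I × W) × I => H r.1 r.2 :=
    Path.continuous_uncurry_iff.2 H.continuous
  refine homotopic_of_family
    ⟨fun r : (W × I) × I => H (r.2, r.1.1) r.1.2, hc.comp
      (f := fun r : (W × I) × I => ((r.2, r.1.1), r.1.2)) (by fun_prop)⟩ ?_ ?_ ?_ ?_
  · intro w t; simp [hμ]
  · intro w t; simp [hμ']
  · intro w s; simp
  · intro w s; simp

theorem homotopic_of_path_homotopic [LocallyCompactSpace W]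
    {μ μ' : Path (ContinuousMap.const W b) (ContinuousMap.const W b)} (h : μ.Homotopic μ')
    {q q' : C(W, Path b b)} (hμ : ∀ t w, μ t w = q w t)
    (hμ' : ∀ t w, μ' t w = q' w t) : q.Homotopic q' := by
  obtain ⟨G, h0, h1, ha, hb⟩ := exists_family_of_homotopic h
  let K : I × W → Path b b := fun r =>
    { toFun := fun t => G ((r.2, t), r.1)
      continuous_toFun := by fun_prop
      source' := ha _ _
      target' := hb _ _ }
  have hK : Continuous K := by
    rw [← Path.continuous_uncurry_iff]
    exact G.continuous.comp (f := fun r : (I × W) × I => ((r.1.2, r.2), r.1.1)) (by fun_prop)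
  refine ⟨⟨⟨K, hK⟩, fun w => ?_, fun w => ?_⟩⟩
  · ext t; exact (h0 w t).trans (hμ t w)
  · ext t; exact (h1 w t).trans (hμ' t w)

end LoopFamilies

/-! ### Maps that behave like the projection onto a smash product -/

section SmashLike

variable {X : Type*} {Y : Type*} {Z : Type*} [TopologicalSpace X] [TopologicalSpace Y]
  [TopologicalSpace Z]

/-- The inclusion of the first axis. -/
def axisLeft (X : Type*) [TopologicalSpace X] (y : Y) : C(X, X × Y) :=
  ⟨fun x => (x, y), by fun_prop⟩

/-- The inclusion of the second axis. -/
def axisRight (x : X) (Y : Type*) [TopologicalSpace Y] : C(Y, X × Y) :=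
  ⟨fun y => (x, y), by fun_prop⟩

/-- Composition with `c` identifies, up to null homotopy, maps out of `Z` with those maps out of
`X × Y` that are null homotopic on both axes. -/
def IsSmashLike (c : C(X × Y, Z)) (x₀ : X) (y₀ : Y) : Prop :=
  ∀ (B : Type w) [TopologicalSpace B] (b : B),
    (∀ g : C(Z, B), (g.comp c).Homotopic (ContinuousMap.const _ b) →
      g.Homotopic (ContinuousMap.const _ b)) ∧
    ∀ k : C(X × Y, B), (k.comp (axisLeft X y₀)).Homotopic (ContinuousMap.const _ b) →
      (k.comp (axisRight x₀ Y)).Homotopic (ContinuousMap.const _ b) →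
      ∃ g : C(Z, B), (g.comp c).Homotopic k

namespace IsSmashLike

variable {c : C(X × Y, Z)} {x₀ : X} {y₀ : Y} (hc : IsSmashLike.{w} c x₀ y₀) {B : Type w}
  [TopologicalSpace B] {b : B}

include hc

/-- The uniqueness half of the smash property, for maps into the loop space of `B` at `b`. -/
theorem path_homotopic_refl [LocallyCompactSpace X] [LocallyCompactSpace Y] [LocallyCompactSpace Z]
    {μ : Path (ContinuousMap.const Z b) (ContinuousMap.const Z b)}
    {ν : Path (ContinuousMap.const (X × Y) b) (ContinuousMap.const (X × Y) b)}
    (hν : ∀ t r, ν t r = μ t (c r)) (h : ν.Homotopic (Path.refl _)) :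
    μ.Homotopic (Path.refl _) := by
  refine path_homotopic_of_homotopic ((hc (Path b b) (Path.refl b)).1 (toLoopFamily μ) ?_)
    (fun _ _ => rfl) (fun _ _ => rfl)
  exact homotopic_of_path_homotopic h hν (fun _ _ => rfl)

/-- The existence half, for maps into the loop space of `B` at `b`. -/
theorem exists_path [LocallyCompactSpace X] [LocallyCompactSpace Y]
    (ν : Path (ContinuousMap.const (X × Y) b) (ContinuousMap.const (X × Y) b))
    {νX : Path (ContinuousMap.const X b) (ContinuousMap.const X b)}
    {νY : Path (ContinuousMap.const Y b) (ContinuousMap.const Y b)}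
    (hX : ∀ t x, νX t x = ν t (x, y₀)) (hY : ∀ t y, νY t y = ν t (x₀, y))
    (hX' : νX.Homotopic (Path.refl _)) (hY' : νY.Homotopic (Path.refl _)) :
    ∃ μ : Path (ContinuousMap.const Z b) (ContinuousMap.const Z b),
      ∀ ν' : Path (ContinuousMap.const (X × Y) b) (ContinuousMap.const (X × Y) b),
        (∀ t r, ν' t r = μ t (c r)) → ν'.Homotopic ν := by
  obtain ⟨g, hg⟩ := (hc (Path b b) (Path.refl b)).2 (toLoopFamily ν)
    (homotopic_of_path_homotopic hX' hX (fun _ _ => rfl))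
    (homotopic_of_path_homotopic hY' hY (fun _ _ => rfl))
  exact ⟨ofLoopFamily g, fun ν' h => path_homotopic_of_homotopic hg h (fun _ _ => rfl)⟩

end IsSmashLike

end SmashLike

/-! ### The smash property: the case of S⁰ and the suspension step -/

section Step

theorem homotopic_of_bool {Y B : Type*} [TopologicalSpace Y] [TopologicalSpace B]
    {f g : C(Bool × Y, B)}
    (h : ∀ i, (f.comp (axisRight i Y)).Homotopic (g.comp (axisRight i Y))) : f.Homotopic g := by
  let H := fun i => Classical.choice (h i)
  have hc : Continuous fun r : Bool × I × Y => H r.1 r.2 :=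
    continuous_prod_of_discrete_left.2 fun i => (H i).continuous
  refine ⟨⟨⟨fun r => H r.2.1 (r.1, r.2.2), hc.comp
    (f := fun r : I × Bool × Y => (r.2.1, r.1, r.2.2)) (by fun_prop)⟩, ?_, ?_⟩⟩
  · rintro ⟨i, y⟩
    exact (H i).map_zero_left y
  · rintro ⟨i, y⟩
    exact (H i).map_one_left y

/-- S⁰ × Sᵐ is two copies of Sᵐ; the product is the identity on the `false` copy and constant on the
`true` copy. Restriction to the `false` copy gives both halves, the hypotheses on the axes taking
care of the `true` copy. -/
theorem isSmashLike_cupZero (m : ℕ) : IsSmashLike.{w} (cupZero m) (Sphere 0).pt (Sphere m).pt := by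
  intro B _ b
  refine ⟨fun g hg => ?_, fun k hX hY => ?_⟩
  · exact (hg.comp (ContinuousMap.Homotopic.refl (axisRight (false : Bool) (Sphere m))):)
  · refine ⟨k.comp (axisRight (false : Bool) (Sphere m)), ?_⟩
    refine homotopic_of_bool (Y := Sphere m) ?_
    rintro (_ | _)
    · exact ContinuousMap.Homotopic.refl _
    · have h := hX.comp (ContinuousMap.Homotopic.refl
        (ContinuousMap.const (Sphere m) (false : Bool)))
      exact ContinuousMap.Homotopic.trans h hY.symm

variable {X Y Z : PointedSpace.{u}} {B : Type w} [TopologicalSpace B]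

/-- A map out of a suspension is homotopic, relative to the north pole, to the one obtained by
restricting it along `σ`. -/
theorem homotopicRel_sigma [LocallyCompactSpace X] {f f' : C(Susp X, B)}
    (h : ∀ t x, f' (Susp.mk (x, t)) = f (Susp.sigma x t)) :
    f.HomotopicRel f' {(Susp X).pt} := by
  let μ : Path (ContinuousMap.const X (f (Susp X).pt)) (ContinuousMap.const X (f Susp.south)) :=
    push f (meridPath X) (by simp) (by simp)
  -- The south pole is dragged back to the north pole along the base meridian, a path independent of
  -- the point of `X`.
  let β : Path (ContinuousMap.const X (f Susp.south)) (ContinuousMap.const X (f (Susp X).pt)) :=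
    (push f (meridPathBase X) (by simp) (by simp)).symm
  refine isCylinder_susp.homotopicRel_of_trans (μ := μ) β (fun _ _ => rfl) ?_ (fun _ _ => rfl) ?_
  · intro t x
    refine (h t x).trans ?_
    rw [← sigmaPath_apply, sigmaPath, Path.trans_apply, Path.trans_apply]
    split_ifs <;> rfl
  · rintro d rfl
    exact ⟨X.pt, rfl⟩

theorem hat_north [CompactSpace X] (c : C(X × Y, Z)) (y : Y) :
    hat c ((Susp X).pt, y) = (Susp Z).pt :=
  (Susp.sigma (c (X.pt, y))).source

theorem sigma_push_homotopic_refl {W : Type*} [TopologicalSpace W] (g : C(Susp Z, B))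
    {a : B} (ha : g (Susp Z).pt = a) {μ : Path (ContinuousMap.const W a) (ContinuousMap.const W a)}
    (h : ∀ t w, μ t w = g (Susp.sigma Z.pt t)) : μ.Homotopic (Path.refl _) := by
  subst ha
  let σ₀ : Path (ContinuousMap.const W (Susp Z).pt) (ContinuousMap.const W (Susp Z).pt) :=
    pull (sigmaPath Z) (ContinuousMap.const W Z.pt) (by simp) (by simp)
  have h₀ := homotopic_push (sigma_base_homotopic (μ := σ₀) fun t w => sigmaPath_apply t _) g
    (a' := ContinuousMap.const W (g (Susp Z).pt)) (b' := ContinuousMap.const W (g (Susp Z).pt))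
    (by simp) (by simp)
  have h₁ : μ = push g σ₀ (by simp) (by simp) := path_ext₂ fun t w => by
    rw [h, ← sigmaPath_apply]; rfl
  rw [h₁]
  exact h₀

variable [CompactSpace X] [LocallyCompactSpace X] [LocallyCompactSpace Y] [LocallyCompactSpace Z]
  {c : C(X × Y, Z)}

/-- The meridians of the first factor, as a path of maps `X × Y → Susp X × Y`. -/
def meridProdPath (X Y : PointedSpace.{u}) :
    Path (⟨fun r => ((Susp X).pt, r.2), by fun_prop⟩ : C(X × Y, Susp X × Y))
      ⟨fun r => (Susp.south, r.2), by fun_prop⟩ :=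
  familyPath (suspProdMk X Y) _ _ (fun r => Prod.ext (Susp.merid r.1).source rfl)
    (fun r => Prod.ext (Susp.merid r.1).target rfl)

/-- The retraction of `X × Y` onto the second axis. -/
def ontoAxisRight (X Y : PointedSpace.{u}) : C(X × Y, X × Y) := ⟨fun r => (X.pt, r.2), by fun_prop⟩

/-- The loops g ∘ σ ∘ c are images under the null homotopic g ∘ `hat c` of meridians. They can thus
be compared with their values on {⋆} × Y, which are g(σ(⋆)) and contract. By the smash property of
`c`, g ∘ σ is null, and it determines `g` up to homotopy. -/
theorem IsSmashLike.homotopic_const_of_hat (hc : IsSmashLike.{w} c X.pt Y.pt)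
    (h0 : ∀ y, c (X.pt, y) = Z.pt) (g : C(Susp Z, B)) {b : B}
    (hg : (g.comp (hat c)).Homotopic (ContinuousMap.const _ b)) :
    g.Homotopic (ContinuousMap.const _ b) := by
  let μ : Path (ContinuousMap.const Z (g (Susp Z).pt)) (ContinuousMap.const Z (g (Susp Z).pt)) :=
    push g (sigmaPath Z) (by simp) (by simp)
  let ν : Path (ContinuousMap.const (X × Y) (g (Susp Z).pt))
      (ContinuousMap.const (X × Y) (g (Susp Z).pt)) := pull μ c (by simp) (by simp)
  let ν₀ : Path (ContinuousMap.const (X × Y) (g (Susp Z).pt))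
      (ContinuousMap.const (X × Y) (g (Susp Z).pt)) :=
    pull ν (ontoAxisRight X Y) (by simp) (by simp)
  have hν : ∀ t r, ν t r = g (Susp.sigma (c r) t) := fun t r =>
    congrArg g (sigmaPath_apply t (c r))
  have hν₀ : ν₀.Homotopic (Path.refl _) := sigma_push_homotopic_refl g rfl fun t r => by
    rw [← h0 r.2]; exact hν t _
  have h₁ : ν.Homotopic ν₀ := homotopic_of_nullhomotopic hg (meridProdPath X Y)
    (pull (meridProdPath X Y) (ontoAxisRight X Y) (fun _ => rfl) (fun _ => rfl))
    hν (fun t r => hν t _)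
  have h₂ : μ.Homotopic (Path.refl _) :=
    hc.path_homotopic_refl (fun _ _ => rfl) (h₁.trans hν₀)
  obtain ⟨g', hg'⟩ := isCylinder_susp.exists_lift_path μ (fun _ => rfl) (fun _ => rfl)
  have h₃ : g.HomotopicRel g' {(Susp Z).pt} := homotopicRel_sigma fun t x =>
    (hg' t x).trans (congrArg g (sigmaPath_apply t x))
  have h₄ : g'.HomotopicRel (ContinuousMap.const _ (g (Susp Z).pt)) ∅ :=
    isCylinder_susp.homotopicRel_of_path_homotopic h₂ hg' (fun _ _ => rfl) (by simp)
  have h₅ := hg.comp (ContinuousMap.Homotopic.refl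
    (ContinuousMap.const (Susp Z) ((Susp X).pt, Y.pt)))
  have h₆ : (g.comp (hat c)).comp (ContinuousMap.const (Susp Z) ((Susp X).pt, Y.pt)) =
      ContinuousMap.const _ (g (Susp Z).pt) :=
    ContinuousMap.ext fun _ => congrArg g (hat_north c Y.pt)
  rw [h₆] at h₅
  exact (h₃.homotopic.trans h₄.homotopic).trans h₅

/-- Dragging both ends of the meridians to `b` turns `k` into a family ν of loops over X × Y. It is
null on both axes, so it comes from a family μ over `Z`, which defines `g` on the meridians of `Susp
Z`. -/
theorem IsSmashLike.exists_of_hat (hc : IsSmashLike.{w} c X.pt Y.pt)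
    (h0 : ∀ y, c (X.pt, y) = Z.pt) (k : C(Susp X × Y, B)) {b : B}
    (hX : (k.comp (axisLeft (Susp X) Y.pt)).Homotopic (ContinuousMap.const _ b))
    (hY : (k.comp (axisRight (Susp X).pt Y)).Homotopic (ContinuousMap.const _ b)) :
    ∃ g : C(Susp Z, B), (g.comp (hat c)).Homotopic k := by
  obtain ⟨H⟩ := hY.symm
  let kN : C(X × Y, B) := ⟨fun r => k ((Susp X).pt, r.2), by fun_prop⟩
  let kS : C(X × Y, B) := ⟨fun r => k (Susp.south, r.2), by fun_prop⟩
  let α : Path (ContinuousMap.const (X × Y) b) kN :=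
    familyPath (H.toContinuousMap.comp ⟨fun r : (X × Y) × I => (r.2, r.1.2), by fun_prop⟩) _ _
      (fun r => H.map_zero_left r.2) (fun r => H.map_one_left r.2)
  let ρ : Path kN kS := push k (meridProdPath X Y) (fun _ => rfl) (fun _ => rfl)
  let ρ₀ : Path kN kS := pull ρ (ontoAxisRight X Y) (fun _ => rfl) (fun _ => rfl)
  -- α contracts `k` on {north} × Y, ρ follows the meridian of x and ρ₀ the base meridian. Both α
  -- and ρ₀ depend on y only, so the ends can be dragged along them. Over {⋆} × Y everything
  -- cancels; over X × {⋆} the null homotopy of `k` identifies ρ with ρ₀.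
  let ν : Path (ContinuousMap.const (X × Y) b) (ContinuousMap.const (X × Y) b) :=
    α.trans (ρ.trans (ρ₀.symm.trans α.symm))
  have hcyl := isCylinder_suspProd (X := X) (Y := Y)
  obtain ⟨f₁, hf₁⟩ := hcyl.exists_lift_path (ρ.trans (ρ₀.symm.trans α.symm))
    (fun {r r'} h => congrArg (fun y => k ((Susp X).pt, y)) h) (fun _ => rfl)
  obtain ⟨f₂, hf₂⟩ := hcyl.exists_lift_path ν (fun _ => rfl) (fun _ => rfl)
  have hα : ∀ {r r' : X × Y} t, r.2 = r'.2 → α t r = α t r' := fun t h =>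
    congrArg (fun y => H (t, y)) h
  have hρ₀ : ∀ {r r' : X × Y} t, r.2 = r'.2 → ρ₀ t r = ρ₀ t r' := fun t h =>
    congrArg (fun y => k (Susp.mk (X.pt, t), y)) h
  have hk₁ : k.HomotopicRel f₁ ∅ := hcyl.homotopicRel_of_trans (μ := ρ) (ρ₀.symm.trans α.symm)
    (fun _ _ => rfl) hf₁ (fun {r r'} t h => by
      rw [Path.trans_apply]
      split_ifs
      · exact hρ₀ _ h
      · exact hα _ h) (by simp)
  have hk₂ : f₁.HomotopicRel f₂ ∅ := hcyl.homotopicRel_of_trans_left α hf₁ hf₂ hα (by simp)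
  let νY : Path (ContinuousMap.const Y b) (ContinuousMap.const Y b) :=
    pull ν (axisRight X.pt Y) (by simp) (by simp)
  have hνY : νY.Homotopic (Path.refl _) := by
    let α' : Path (ContinuousMap.const Y b) (kN.comp (axisRight X.pt Y)) :=
      pull α (axisRight X.pt Y) (by simp) (fun _ => rfl)
    let ρ' : Path (kN.comp (axisRight X.pt Y)) (kS.comp (axisRight X.pt Y)) :=
      pull ρ (axisRight X.pt Y) (fun _ => rfl) (fun _ => rfl)
    have : νY = α'.trans (ρ'.trans (ρ'.symm.trans α'.symm)) := path_ext₂ fun t y => by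
      change ν t (X.pt, y) = _
      simp only [ν, Path.trans_apply]
      split_ifs <;> rfl
    rw [this]
    apply Path.Homotopic.Quotient.exact
    simp only [Path.Homotopic.Quotient.mk_trans, Path.Homotopic.Quotient.mk_symm]
    rw [← Path.Homotopic.Quotient.trans_assoc (Path.Homotopic.Quotient.mk ρ'),
      Path.Homotopic.Quotient.trans_symm, Path.Homotopic.Quotient.refl_trans,
      Path.Homotopic.Quotient.trans_symm, Path.Homotopic.Quotient.mk_refl]
  let νX : Path (ContinuousMap.const X b) (ContinuousMap.const X b) :=
    pull ν (axisLeft X Y.pt) (by simp) (by simp)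
  have hνX : νX.Homotopic (Path.refl _) := by
    let α' : Path (ContinuousMap.const X b) (kN.comp (axisLeft X Y.pt)) :=
      pull α (axisLeft X Y.pt) (by simp) (fun _ => rfl)
    let ρ' : Path (kN.comp (axisLeft X Y.pt)) (kS.comp (axisLeft X Y.pt)) :=
      pull ρ (axisLeft X Y.pt) (fun _ => rfl) (fun _ => rfl)
    let ρ₀' : Path (kN.comp (axisLeft X Y.pt)) (kS.comp (axisLeft X Y.pt)) :=
      pull ρ₀ (axisLeft X Y.pt) (fun _ => rfl) (fun _ => rfl)
    have hρ : ρ'.Homotopic ρ₀' := homotopic_of_nullhomotopic hX (meridPath X) (meridPathBase X)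
      (fun _ _ => rfl) (fun _ _ => rfl)
    have : νX = α'.trans (ρ'.trans (ρ₀'.symm.trans α'.symm)) := path_ext₂ fun t x => by
      change ν t (x, Y.pt) = _
      simp only [ν, Path.trans_apply]
      split_ifs <;> rfl
    rw [this]
    apply Path.Homotopic.Quotient.exact
    simp only [Path.Homotopic.Quotient.mk_trans, Path.Homotopic.Quotient.mk_symm]
    rw [Path.Homotopic.Quotient.eq.2 hρ,
      ← Path.Homotopic.Quotient.trans_assoc (Path.Homotopic.Quotient.mk ρ₀'),
      Path.Homotopic.Quotient.trans_symm, Path.Homotopic.Quotient.refl_trans,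
      Path.Homotopic.Quotient.trans_symm, Path.Homotopic.Quotient.mk_refl]
  obtain ⟨μ, hμ⟩ := hc.exists_path ν (νX := νX) (νY := νY) (fun _ _ => rfl) (fun _ _ => rfl) hνX hνY
  obtain ⟨g, hg⟩ := isCylinder_susp.exists_lift_path μ (fun _ => rfl) (fun _ => rfl)
  refine ⟨g, ?_⟩
  let μc : Path (ContinuousMap.const (X × Y) b) (ContinuousMap.const (X × Y) b) :=
    pull μ c (by simp) (by simp)
  let μ₀ : Path (ContinuousMap.const (X × Y) b) (ContinuousMap.const (X × Y) b) :=
    pull μc (ontoAxisRight X Y) (by simp) (by simp)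
  have hμc : μc.Homotopic ν := hμ μc fun _ _ => rfl
  -- On {⋆} × Y the family μ ∘ c is homotopic to the restriction of ν, which is null.
  have hμ₀ : μ₀.Homotopic (Path.refl _) := by
    have h₁ := homotopic_pull hμc (ontoAxisRight X Y) (a' := ContinuousMap.const (X × Y) b)
      (b' := ContinuousMap.const (X × Y) b) (by simp) (by simp)
    have h₂ := homotopic_pull hνY (ContinuousMap.snd : C(X × Y, Y))
      (a' := ContinuousMap.const (X × Y) b) (b' := ContinuousMap.const (X × Y) b)
      (by simp) (by simp)
    exact h₁.trans h₂
  have hτ : (μc.trans μ₀.symm).Homotopic ν := by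
    apply Path.Homotopic.Quotient.exact
    rw [Path.Homotopic.Quotient.mk_trans, Path.Homotopic.Quotient.mk_symm,
      Path.Homotopic.Quotient.eq.2 hμ₀, Path.Homotopic.Quotient.eq.2 hμc,
      ← Path.Homotopic.Quotient.mk_symm, Path.refl_symm, Path.Homotopic.Quotient.mk_refl,
      Path.Homotopic.Quotient.trans_refl]
  -- Along a meridian, g ∘ `hat c` runs through g ∘ σ ∘ c. This is μ ∘ c followed by the inverse of
  -- μ(⋆), and ⋆ = c(⋆, y).
  have hk₃ : (g.comp (hat c)).HomotopicRel f₂ ∅ := by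
    refine hcyl.homotopicRel_of_path_homotopic hτ (fun t r => ?_) hf₂ (by simp)
    have : (g.comp (hat c)) (suspProdMk X Y (r, t)) = g (sigmaPath Z t (c r)) :=
      congrArg g (sigmaPath_apply t (c r)).symm
    rw [this, sigmaPath, Path.trans_apply, Path.trans_apply]
    split_ifs with ht
    · exact hg _ _
    · refine (hg _ _).trans ?_
      change _ = μ _ (c (X.pt, r.2))
      rw [h0]
      rfl
  exact hk₃.homotopic.trans (hk₁.homotopic.trans hk₂.homotopic).symm

theorem IsSmashLike.hat (hc : IsSmashLike.{w} c X.pt Y.pt) (h0 : ∀ y, c (X.pt, y) = Z.pt) :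
    IsSmashLike.{w} (hat c) (Susp X).pt Y.pt := fun _ _ _ =>
  ⟨fun g hg => hc.homotopic_const_of_hat h0 g hg, fun k hX hY => hc.exists_of_hat h0 k hX hY⟩

end Step

/-! ### The product of spheres on its axes and its smash property -/

section Cup

theorem cup_pt_left : ∀ (n m : ℕ) (y : Sphere m), cup n m ((Sphere n).pt, y) = (Sphere (m + n)).pt
  | 0, _, _ => rfl
  | n + 1, m, y => hat_north (X := Sphere n) (cup n m) y

theorem isSmashLike_cup : ∀ n m : ℕ,
    IsSmashLike.{w} (cup n m) (Sphere n).pt (Sphere m).pt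
  | 0, m => isSmashLike_cupZero m
  | n + 1, m => (isSmashLike_cup n m).hat (cup_pt_left n m)

end Cup

section CupAxis

theorem sphere_zero_cases : ∀ x : Sphere 0, x = (true : Bool) ∨ x = (false : Bool)
  | true => Or.inl rfl
  | false => Or.inr rfl

variable {X Y Z : PointedSpace.{u}}

theorem hat_axisLeft_homotopic_const [CompactSpace X] [LocallyCompactSpace X]
    [LocallyCompactSpace Z] {c : C(X × Y, Z)}
    (hc : (c.comp (axisLeft X Y.pt)).Homotopic (ContinuousMap.const X Z.pt)) :
    ((hat c).comp (axisLeft (Susp X) Y.pt)).Homotopic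
      (ContinuousMap.const (Susp X) (Susp Z).pt) := by
  let μ : Path (ContinuousMap.const X (Susp Z).pt) (ContinuousMap.const X (Susp Z).pt) :=
    pull (sigmaPath Z) (c.comp (axisLeft X Y.pt)) (by simp) (by simp)
  let ν : Path (ContinuousMap.const X (Susp Z).pt) (ContinuousMap.const X (Susp Z).pt) :=
    pull (sigmaPath Z) (ContinuousMap.const X Z.pt) (by simp) (by simp)
  have h₁ : μ.Homotopic ν := homotopic_pull_of_homotopic hc (sigmaPath Z) (fun _ => rfl)
    (fun _ => rfl) (fun _ _ => rfl) (fun _ _ => rfl)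
  have h₂ : ν.Homotopic (Path.refl _) := sigma_base_homotopic fun t _ => sigmaPath_apply t _
  have h₃ : ((hat c).comp (axisLeft (Susp X) Y.pt)).HomotopicRel
      (ContinuousMap.const (Susp X) (Susp Z).pt) ∅ :=
    isCylinder_susp.homotopicRel_of_path_homotopic (h₁.trans h₂)
      (fun t x => (sigmaPath_apply t (c (x, Y.pt))).symm) (fun _ _ => rfl) (by simp)
  exact h₃.homotopic

/-- Unlike on the other axis, the product is constant here only up to homotopy once n > 0: σ(⋆) runs
along a meridian and back. -/
theorem cup_axisLeft_homotopic_const : ∀ n m : ℕ,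
    ((cup n m).comp (axisLeft (Sphere n) (Sphere m).pt)).Homotopic
      (ContinuousMap.const (Sphere n) (Sphere (m + n)).pt)
  | 0, m => by
    have : (cup 0 m).comp (axisLeft (Sphere 0) (Sphere m).pt) =
        ContinuousMap.const (Sphere 0) (Sphere (m + 0)).pt := by
      ext x
      rcases sphere_zero_cases x with rfl | rfl <;> rfl
    rw [this]
  | n + 1, m => hat_axisLeft_homotopic_const (X := Sphere n) (Y := Sphere m)
      (cup_axisLeft_homotopic_const n m)

end CupAxis

/-! ### Well pointed spaces -/

section WellPointed

/-- The base point is a deformation retract of a neighbourhood, by a deformation of the whole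
space. -/
def WellPointed (X : PointedSpace.{u}) : Prop :=
  ∃ (v : C(X, I)) (h : C(I × X, X)), v X.pt = 0 ∧ (∀ x, h (0, x) = x) ∧
    (∀ s, h (s, X.pt) = X.pt) ∧ ∀ x, v x = 1 ∨ h (1, x) = X.pt

theorem wellPointed_susp (X : PointedSpace.{u}) : WellPointed (Susp X) := by
  have hm0 : ∀ t : I, min 1 (2 * (t : ℝ)) ∈ I := fun t =>
    ⟨le_min zero_le_one (by have := t.2.1; positivity), min_le_left _ _⟩
  have hm1 : ∀ r : I × I, max 0 ((1 + (r.1 : ℝ)) * r.2 - r.1) ∈ I := fun r =>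
    ⟨le_max_left _ _, max_le zero_le_one (by
      have h1 := r.1.2; have h2 := r.2.2
      nlinarith [h1.1, h1.2, h2.1, h2.2])⟩
  -- The height function is min(1, 2t), and the deformation ends with t ↦ max(0, 2t − 1). Below
  -- height 1 one has t < 1/2, and such points are pushed to the north pole.
  let φ : C(I, I) := ⟨fun t => ⟨min 1 (2 * (t : ℝ)), hm0 t⟩, by fun_prop⟩
  let ψ : C(I × I, I) := ⟨fun r => ⟨max 0 ((1 + (r.1 : ℝ)) * r.2 - r.1), hm1 r⟩, by fun_prop⟩
  have hψ0 : ∀ s, ψ (s, 0) = 0 := fun s => by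
    ext; simpa [ψ] using s.2.1
  have hψ1 : ∀ s, ψ (s, 1) = 1 := fun s => by ext; simp [ψ]
  have hcyl := isCylinder_susp (X := X)
  obtain ⟨v, hv⟩ := hcyl.exists_lift (φ.comp ContinuousMap.snd) (fun _ => rfl) (fun _ => rfl)
  obtain ⟨k, hk⟩ := hcyl.exists_lift
    ((suspMk X).comp ⟨fun r : X × I => (r.1, ψ (1, r.2)), by fun_prop⟩)
    (fun {w w'} _ => by simpa [hψ0] using hcyl.eq_zero (w := w) (w' := w') rfl)
    (fun {w w'} _ => by simpa [hψ1] using hcyl.eq_one (w := w) (w' := w') rfl)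
  have hrel : (ContinuousMap.id (Susp X)).HomotopicRel k {(Susp X).pt} := by
    refine hcyl.homotopicRel ((suspMk X).comp
      ⟨fun r : (X × I) × I => (r.1.1, ψ (r.2, r.1.2)), by fun_prop⟩) ?_ ?_ ?_ ?_ ?_
    · intro w w' s _
      simpa [hψ0] using hcyl.eq_zero (w := w) (w' := w') rfl
    · intro w w' s _
      simpa [hψ1] using hcyl.eq_one (w := w) (w' := w') rfl
    · rintro ⟨x, t⟩
      have : ψ (0, t) = t := by ext; have := t.2.1; simp [ψ, this]
      simp [this]
    · rintro r
      exact (hk r).symm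
    · rintro d rfl
      refine ⟨(X.pt, 0), rfl, fun s => ?_⟩
      simp [hψ0]
      rfl
  obtain ⟨H⟩ := hrel
  refine ⟨v, H.toContinuousMap, ?_, fun x => H.map_zero_left x, fun s => H.eq_fst s rfl, ?_⟩
  · refine (hv (X.pt, 0)).trans ?_
    ext
    simp [φ]
  · intro d
    obtain ⟨⟨x, t⟩, rfl⟩ := hcyl.isQuotientMap.surjective d
    rcases le_total (1 : ℝ) (2 * t) with ht | ht
    · left
      rw [hv]
      ext
      simp [φ, ht]
    · right
      refine (H.map_one_left _).trans ((hk _).trans ?_)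
      have : ψ (1, t) = 0 := by ext; simp [ψ]; linarith
      simp only [ContinuousMap.comp_apply, ContinuousMap.coe_mk, this]
      exact hcyl.eq_zero (w' := X.pt) rfl

theorem wellPointed_sphere : ∀ n, WellPointed (Sphere n)
  | 0 => by
    refine ⟨(⟨fun i => if i then 0 else 1, continuous_of_discreteTopology⟩ : C(Bool, I)),
      ContinuousMap.snd, rfl, fun _ => rfl, fun _ => rfl, ?_⟩
    intro x
    rcases sphere_zero_cases x with rfl | rfl
    · exact Or.inr rfl
    · exact Or.inl rfl
  | n + 1 => wellPointed_susp (Sphere n)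

end WellPointed

/-! ### Restricting a map out of a join along ℓ -/

section JoinRestriction

variable {X : PointedSpace.{u}} {Y : PointedSpace.{v}} {A : Type w} [TopologicalSpace A]
  {W W' : Type*} [TopologicalSpace W] [TopologicalSpace W']

/-- The initial segments of length `v w` of the paths from `inl (φ w)` to `inr ⋆`, mapped to `A`. -/
def segmentPath (f : C(Join X Y, A)) (φ : C(W, X)) (v : C(W, I)) {a b : C(W, A)}
    (ha : ∀ w, f (joinMk X Y ((φ w, Y.pt), 0)) = a w)
    (hb : ∀ w, f (joinMk X Y ((φ w, Y.pt), v w)) = b w) : Path a b :=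
  familyPath (f.comp ((joinMk X Y).comp
    ⟨fun r : W × I => ((φ r.1, Y.pt), r.2 * v r.1), by fun_prop⟩)) _ _
    (fun w => by simpa using ha w) (fun w => by simpa using hb w)

/-- The path from `inl ⋆` to `inl (φ w)` that runs back and forth over segments of length `v w`. -/
noncomputable def detourPath (f : C(Join X Y, A)) (φ : C(W, X)) (v : C(W, I))
    (hv : ∀ w, v w = 1 ∨ φ w = X.pt) {a : C(W, A)}
    (ha : ∀ w, f (joinMk X Y ((φ w, Y.pt), 0)) = a w) :
    Path (ContinuousMap.const W (f (Join X Y).pt)) a :=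
  (segmentPath f (ContinuousMap.const W X.pt) v
    (b := f.comp ((joinMk X Y).comp ⟨fun w : W => ((X.pt, Y.pt), v w), by fun_prop⟩))
    (fun _ => rfl) (fun _ => rfl)).trans
  -- The two segments meet: at full length both end at inr ⋆, and otherwise both run along the same
  -- segment.
  (segmentPath f φ v ha fun w => by
    rcases hv w with h | h
    · have := isCylinder_join.eq_one (mk := joinMk X Y) (w := (φ w, Y.pt)) (w' := (X.pt, Y.pt)) rfl
      simp [h, this]
    · simp [h]).symm

theorem detourPath_apply (f : C(Join X Y, A)) {φ : C(W, X)} {v : C(W, I)}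
    (hv : ∀ w, v w = 1 ∨ φ w = X.pt) {a : C(W, A)}
    (ha : ∀ w, f (joinMk X Y ((φ w, Y.pt), 0)) = a w) (t : I) (w : W) :
    detourPath f φ v hv ha t w =
      if ht : (t : ℝ) ≤ 1 / 2 then
        f (joinMk X Y ((X.pt, Y.pt),
          ⟨2 * t, (unitInterval.mul_pos_mem_iff zero_lt_two).2 ⟨t.2.1, ht⟩⟩ * v w))
      else
        f (joinMk X Y ((φ w, Y.pt), unitInterval.symm
          ⟨2 * t - 1, unitInterval.two_mul_sub_one_mem_iff.2 ⟨(not_le.1 ht).le, t.2.2⟩⟩ * v w)) := by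
  rw [detourPath, Path.trans_apply]
  split_ifs <;> rfl

theorem detourPath_congr (f : C(Join X Y, A)) {φ : C(W, X)} {v : C(W, I)}
    (hv : ∀ w, v w = 1 ∨ φ w = X.pt) {a : C(W, A)}
    (ha : ∀ w, f (joinMk X Y ((φ w, Y.pt), 0)) = a w) {φ' : C(W', X)} {v' : C(W', I)}
    (hv' : ∀ w, v' w = 1 ∨ φ' w = X.pt) {a' : C(W', A)}
    (ha' : ∀ w, f (joinMk X Y ((φ' w, Y.pt), 0)) = a' w) {w : W} {w' : W'} (t : I)
    (h : φ w = φ' w') (k : v w = v' w') :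
    detourPath f φ v hv ha t w = detourPath f φ' v' hv' ha' t w' := by
  simp only [detourPath_apply, h, k]

theorem detourPath_homotopic [LocallyCompactSpace W] (f : C(Join X Y, A)) {φ : C(W, X)}
    {v v' : C(W, I)} (hv : ∀ w, v w = 1 ∨ φ w = X.pt) (hv' : ∀ w, v' w = 1 ∨ φ w = X.pt)
    {a : C(W, A)} (ha : ∀ w, f (joinMk X Y ((φ w, Y.pt), 0)) = a w) (hle : v ≤ v') :
    (detourPath f φ v hv ha).Homotopic (detourPath f φ v' hv' ha) := by
  -- This interpolates between `v` and `v'` without dropping below `v`, so every intermediate detour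
  -- still closes up.
  let V : C(W × I, I) := ⟨fun r => max (v r.1) (min (v' r.1) r.2), by fun_prop⟩
  have hV : ∀ r, V r = 1 ∨ (φ.comp ContinuousMap.fst) r = X.pt := by
    rintro ⟨w, s⟩
    rcases hv w with h | h
    · left
      simp [V, h, unitInterval.le_one']
    · exact Or.inr h
  let δ := detourPath f (φ.comp ContinuousMap.fst) V hV (a := a.comp ContinuousMap.fst)
    (fun r => ha r.1)
  refine homotopic_of_family ((family δ).comp
    ⟨fun r : (W × I) × I => ((r.1.1, r.2), r.1.2), by fun_prop⟩) ?_ ?_ ?_ ?_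
  · intro w t
    refine detourPath_congr f hV _ hv ha t rfl ?_
    simp [V]
  · intro w t
    refine detourPath_congr f hV _ hv' ha t rfl ?_
    simpa [V, unitInterval.le_one'] using hle w
  · intro w s; simp
  · intro w s; simp

/-- A map out of a join with well pointed first factor is homotopic, relative to the base point,
to the one obtained by restricting it along `ℓ`. -/
theorem homotopicRel_ell [LocallyCompactSpace X] [LocallyCompactSpace Y] (hX : WellPointed X)
    {f f' : C(Join X Y, A)} (h : ∀ t r, f' (joinMk X Y (r, t)) = f (Join.ell r.1 r.2 t)) :
    f.HomotopicRel f' {(Join X Y).pt} := by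
  obtain ⟨v, d, hv0, hd0, hds, hd1⟩ := hX
  have hcyl := isCylinder_join (X := X) (Y := Y)
  let d₁ : C(X, X) := ⟨fun x => d (1, x), by fun_prop⟩
  let D : C(X × Y, X × Y) := ⟨fun r => (d (1, r.1), r.2), by fun_prop⟩
  let a : C(X × Y, A) := f.comp ((joinMk X Y).comp ⟨fun r => (D r, 0), by fun_prop⟩)
  let b : C(X × Y, A) := f.comp ((joinMk X Y).comp ⟨fun r => (r, 1), by fun_prop⟩)
  have haD : ∀ r : X × Y, f (joinMk X Y ((d (1, r.1), Y.pt), 0)) = a r := fun r =>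
    congrArg f (hcyl.eq_zero rfl)
  let ρ : Path a b := familyPath (f.comp ((joinMk X Y).comp
    ⟨fun r : (X × Y) × I => (D r.1, r.2), by fun_prop⟩)) _ _ (fun _ => rfl)
    (fun r => congrArg f (hcyl.eq_one rfl))
  let β : Path b (ContinuousMap.const (X × Y) (f (Join X Y).pt)) :=
    (familyPath (f.comp ((joinMk X Y).comp
      ⟨fun r : (X × Y) × I => ((X.pt, r.1.2), r.2), by fun_prop⟩))
      (ContinuousMap.const (X × Y) (f (Join X Y).pt)) b
      (fun r => congrArg f (hcyl.eq_zero (w := (X.pt, r.2)) (w' := (X.pt, Y.pt)) rfl))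
      (fun r => congrArg f (hcyl.eq_one (w := (X.pt, r.2)) (w' := r) rfl))).symm
  -- The full detour would move the base point. The detour of length `v` is constant there because
  -- `v` vanishes at ⋆, and it closes up because `d (1, ·)` sends every point with v ≠ 1 to ⋆.
  let α := detourPath f (d₁.comp ContinuousMap.fst) (v.comp ContinuousMap.fst)
    (fun r : X × Y => hd1 r.1) haD
  let α₁ := detourPath f (d₁.comp ContinuousMap.fst) (ContinuousMap.const (X × Y) 1)
    (fun r : X × Y => Or.inl rfl) haD
  have hα : α.Homotopic α₁ := detourPath_homotopic f _ _ haD fun r => unitInterval.le_one'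
  obtain ⟨f₁, hf₁⟩ := hcyl.exists_lift_path ρ
    (fun h => congrArg f (hcyl.eq_zero (congrArg (fun x => d (1, x)) h)))
    (fun h => congrArg f (hcyl.eq_one h))
  obtain ⟨f₂, hf₂⟩ := hcyl.exists_lift_path (ρ.trans β)
    (fun h => congrArg f (hcyl.eq_zero (congrArg (fun x => d (1, x)) h))) (fun _ => rfl)
  obtain ⟨f₃, hf₃⟩ := hcyl.exists_lift_path (α.trans (ρ.trans β)) (fun _ => rfl) (fun _ => rfl)
  have hpt : ∀ z ∈ ({(Join X Y).pt} : Set (Join X Y)), ∃ r, joinMk X Y (r, 0) = z := by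
    rintro z rfl
    exact ⟨(X.pt, Y.pt), rfl⟩
  have h₁ : f.HomotopicRel f₁ {(Join X Y).pt} := by
    refine hcyl.homotopicRel (f.comp ((joinMk X Y).comp
      ⟨fun r : ((X × Y) × I) × I => ((d (r.2, r.1.1.1), r.1.1.2), r.1.2), by fun_prop⟩))
      ?_ ?_ ?_ ?_ ?_
    · intro r r' s hr
      exact congrArg f (hcyl.eq_zero (congrArg (fun x => d (s, x)) hr))
    · intro r r' s hr
      exact congrArg f (hcyl.eq_one hr)
    · rintro ⟨r, t⟩
      simp [hd0]
    · rintro ⟨r, t⟩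
      exact (hf₁ t r).symm
    · rintro z rfl
      refine ⟨((X.pt, Y.pt), 0), rfl, fun s => ?_⟩
      simp only [ContinuousMap.comp_apply, ContinuousMap.coe_mk, hds]
      rfl
  have h₂ : f₁.HomotopicRel f₂ {(Join X Y).pt} := hcyl.homotopicRel_of_trans β hf₁ hf₂
    (fun {r r'} t hr => congrArg (fun y => f (joinMk X Y ((X.pt, y), unitInterval.symm t))) hr) hpt
  have h₃ : f₂.HomotopicRel f₃ {(Join X Y).pt} := by
    refine hcyl.homotopicRel_of_trans_left α hf₂ hf₃ ?_ ?_
    · intro r r' t hr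
      exact detourPath_congr f _ _ _ _ t (congrArg d₁ hr) (congrArg v hr)
    · rintro z rfl
      refine ⟨(X.pt, Y.pt), rfl, fun t => ?_⟩
      have hd : d (1, X.pt) = X.pt := hds 1
      refine (detourPath_apply f _ haD t _).trans ?_
      split_ifs <;> simp [hv0, a, D, d₁, hd]
  let ε : Path (ContinuousMap.const (X × Y) (f (Join X Y).pt))
      (ContinuousMap.const (X × Y) (f (Join X Y).pt)) := push f (ellPath X Y) (by simp) (by simp)
  let εD : Path (ContinuousMap.const (X × Y) (f (Join X Y).pt))
      (ContinuousMap.const (X × Y) (f (Join X Y).pt)) := pull ε D (by simp) (by simp)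
  -- At full length the detour is the first half of ℓ, push(⋆, ⋆) · push(x, ⋆)⁻¹, evaluated at the
  -- deformed point; this bracketing is that of `Join.ell`.
  have hεD : εD = (α₁.trans ρ).trans β := by
    refine path_ext₂ fun t r => ?_
    change f (Join.ell (D r).1 (D r).2 t) = _
    simp only [ell_eval, α₁, Path.trans_apply]
    split_ifs
    · refine Eq.trans ?_ (detourPath_apply f _ haD _ r).symm
      simp only [ContinuousMap.const_apply, mul_one]
      rw [dif_pos ‹_›]
      rfl
    · refine Eq.trans ?_ (detourPath_apply f _ haD _ r).symm
      simp only [ContinuousMap.const_apply, mul_one]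
      rw [dif_neg ‹_›]
      rfl
    · rfl
    · rfl
  have hε : εD.Homotopic ε := by
    refine homotopic_pull_of_homotopic (φ := D) (ψ := ContinuousMap.id _) ?_ ε (fun _ => rfl)
      (fun _ => rfl) (fun _ _ => rfl) (fun _ _ => rfl)
    refine ContinuousMap.Homotopic.symm ⟨⟨⟨fun r => (d (r.1, r.2.1), r.2.2), by fun_prop⟩, ?_, ?_⟩⟩
    · intro r; simp [hd0]
    · intro r; rfl
  have h₄ : (α.trans (ρ.trans β)).Homotopic ε := by
    refine ((Path.Homotopic.hcomp hα (Path.Homotopic.refl _)).trans ?_).trans hε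
    rw [hεD]
    exact (Path.Homotopic.trans_assoc _ _ _).symm
  have h₅ : f₃.HomotopicRel f' {(Join X Y).pt} :=
    hcyl.homotopicRel_of_path_homotopic h₄ hf₃ h hpt
  exact ((h₁.trans h₂).trans h₃).trans h₅

end JoinRestriction

/-! ### The image of ℓ in the suspension -/

section JoinToSusp

variable {X Y Z : PointedSpace.{u}} {c : C(X × Y, Z)}

/-- The image of ℓ(x, y) consists of the meridians of ⋆, c(x, ⋆), c(x, y) and ⋆ with alternating
directions. As c(x, ⋆) contracts to ⋆, the first two cancel and σ(c(x, y)) remains. -/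
theorem joinToSusp_ell_homotopic [LocallyCompactSpace Z] (h0 : ∀ y, c (X.pt, y) = Z.pt)
    (hc : (c.comp (axisLeft X Y.pt)).Homotopic (ContinuousMap.const X Z.pt))
    {μ ν : Path (ContinuousMap.const (X × Y) (Susp Z).pt) (ContinuousMap.const (X × Y) (Susp Z).pt)}
    (hμ : ∀ t r, μ t r = (joinToSusp c).1 (Join.ell r.1 r.2 t))
    (hν : ∀ t r, ν t r = Susp.sigma (c r) t) : μ.Homotopic ν := by
  let M (φ : C(X × Y, Z)) : Path (ContinuousMap.const (X × Y) (Susp Z).pt)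
      (ContinuousMap.const (X × Y) (Susp.south : Susp Z)) :=
    pull (meridPath Z) φ (by simp) (by simp)
  let M₀ := M (ContinuousMap.const _ Z.pt)
  let M₁ := M ((c.comp (axisLeft X Y.pt)).comp ContinuousMap.fst)
  have h₁ : M₁.Homotopic M₀ := homotopic_pull_of_homotopic
    (hc.comp (ContinuousMap.Homotopic.refl ContinuousMap.fst)) (meridPath Z)
    (fun _ => rfl) (fun _ => rfl) (fun _ _ => rfl) (fun _ _ => rfl)
  have hμ' : μ = ((M₀.trans M₁.symm).trans (M c)).trans M₀.symm := by
    refine path_ext₂ fun t r => ?_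
    rw [hμ]
    simp only [ell_eval, Path.trans_apply]
    split_ifs
    · exact congrArg (fun z => Susp.mk (z, _)) (h0 _)
    · rfl
    · rfl
    · exact congrArg (fun z => Susp.mk (z, _)) (h0 _)
  have hν' : ν = (M c).trans M₀.symm := by
    refine path_ext₂ fun t r => ?_
    rw [hν, ← sigmaPath_apply, sigmaPath]
    simp only [Path.trans_apply]
    split_ifs <;> rfl
  rw [hμ', hν']
  apply Path.Homotopic.Quotient.exact
  simp only [Path.Homotopic.Quotient.mk_trans, Path.Homotopic.Quotient.mk_symm,
    Path.Homotopic.Quotient.eq.2 h₁, Path.Homotopic.Quotient.trans_symm,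
    Path.Homotopic.Quotient.refl_trans]

end JoinToSusp

/-! ### Pointed classes and groups of loops -/

section Classes

theorem cls_eq_cls_iff {X : PointedSpace.{u}} {Y : PointedSpace.{v}} {f g : X →⋆ Y} :
    cls f = cls g ↔ PointedHomotopic f g :=
  Quotient.eq (r := pointedSetoid X Y)

theorem cls_surjective {X : PointedSpace.{u}} {Y : PointedSpace.{v}} :
    Function.Surjective (cls : (X →⋆ Y) → HtpyClasses X Y) :=
  Quotient.mk_surjective

/-- Pointed homotopic maps send a family of loops to homotopic families of loops. -/
theorem homotopic_push_of_pointedHomotopic {D : PointedSpace.{u}} {A : PointedSpace.{v}}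
    {W : Type*} [TopologicalSpace W] [LocallyCompactSpace W] {f g : D →⋆ A}
    (h : PointedHomotopic f g) (m : Path (ContinuousMap.const W D.pt) (ContinuousMap.const W D.pt))
    {μ ν : Path (ContinuousMap.const W A.pt) (ContinuousMap.const W A.pt)}
    (hμ : ∀ t w, μ t w = f.1 (m t w)) (hν : ∀ t w, ν t w = g.1 (m t w)) : μ.Homotopic ν := by
  obtain ⟨H⟩ := h
  have hH : ∀ s, H (s, D.pt) = A.pt := fun s => (H.eq_fst s rfl).trans f.2
  refine homotopic_of_family (H.toContinuousMap.comp
    ⟨fun r : (W × I) × I => (r.2, family m r.1), by fun_prop⟩) ?_ ?_ ?_ ?_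
  · intro w t
    exact (H.map_zero_left _).trans (hμ t w).symm
  · intro w t
    exact (H.map_one_left _).trans (hν t w).symm
  · intro w s
    simpa using hH s
  · intro w s
    simpa using hH s

/-- The homotopy classes of loops at a point, as a group under concatenation. -/
@[reducible]
noncomputable def loopGroup {E : Type*} [TopologicalSpace E] (x : E) :
    Group (Path.Homotopic.Quotient x x) where
  mul := Path.Homotopic.Quotient.trans
  one := Path.Homotopic.Quotient.refl x
  inv := Path.Homotopic.Quotient.symm
  mul_assoc := Path.Homotopic.Quotient.trans_assoc
  one_mul := Path.Homotopic.Quotient.refl_trans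
  mul_one := Path.Homotopic.Quotient.trans_refl
  inv_mul_cancel := Path.Homotopic.Quotient.symm_trans

theorem exists_group_of_injective {G H : Type*} [Group H] {φ : G → H} (hφ : Function.Injective φ)
    (mul : G → G → G) (hmul : ∀ a b, φ (mul a b) = φ a * φ b) (hone : ∃ a, φ a = 1)
    (hinv : ∀ a, ∃ b, φ b = (φ a)⁻¹) : ∃ _ : Group G, ∀ a b : G, a * b = mul a b := by
  obtain ⟨e, he⟩ := hone
  choose i hi using hinv
  let : Mul G := ⟨mul⟩
  let : One G := ⟨e⟩
  let : Inv G := ⟨i⟩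
  refine ⟨Group.ofLeftAxioms (fun a b c => hφ ?_) (fun a => hφ ?_) (fun a => hφ ?_),
    fun _ _ => rfl⟩
  · change φ (mul (mul a b) c) = φ (mul a (mul b c))
    simp only [hmul, mul_assoc]
  · change φ (mul e a) = φ a
    rw [hmul, he, one_mul]
  · change φ (mul (i a) a) = φ e
    rw [hmul, hi, he, inv_mul_cancel]

end Classes

/-! ### The group of classes of maps out of a suspension -/

section SuspensionGroup

variable {X : PointedSpace.{u}} {A : PointedSpace.{v}}

/-- The family of loops `f ∘ σ`. -/
noncomputable def sigmaLoop (f : Susp X →⋆ A) :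
    Path (ContinuousMap.const X A.pt) (ContinuousMap.const X A.pt) :=
  push f.1 (sigmaPath X) (fun _ => f.2.symm) (fun _ => f.2.symm)

theorem sigmaLoop_apply (f : Susp X →⋆ A) (t : I) (x : X) :
    sigmaLoop f t x = f.1 (Susp.sigma x t) := congrArg f.1 (sigmaPath_apply t x)

/-- The value of a path of maps out of `X` at the base point, as a constant family. -/
def basePath {B : Type*} [TopologicalSpace B] {b : B}
    (μ : Path (ContinuousMap.const X b) (ContinuousMap.const X b)) :
    Path (ContinuousMap.const X b) (ContinuousMap.const X b) :=
  pull μ (ContinuousMap.const X X.pt) (by simp) (by simp)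

theorem basePath_sigmaLoop_homotopic (f : Susp X →⋆ A) :
    (basePath (sigmaLoop f)).Homotopic (Path.refl _) :=
  sigma_push_homotopic_refl f.1 f.2 fun t _ => sigmaLoop_apply f t X.pt

/-- f ∘ σ is μ followed by the inverse of its value at ⋆. A loop of maps is thus realised by
restriction along σ as soon as its value at the base point is null. -/
theorem sigmaLoop_homotopic_of_eq {f : Susp X →⋆ A}
    {μ : Path (ContinuousMap.const X A.pt) (ContinuousMap.const X A.pt)}
    (hf : ∀ t x, f.1 (Susp.mk (x, t)) = μ t x) (hμ : (basePath μ).Homotopic (Path.refl _)) :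
    (sigmaLoop f).Homotopic μ := by
  have h : sigmaLoop f = μ.trans (basePath μ).symm := path_ext₂ fun t x => by
    change f.1 (sigmaPath X t x) = _
    rw [sigmaPath, Path.trans_apply, Path.trans_apply]
    split_ifs
    · exact hf _ _
    · exact hf _ _
  rw [h]
  apply Path.Homotopic.Quotient.exact
  rw [Path.Homotopic.Quotient.mk_trans, Path.Homotopic.Quotient.mk_symm,
    Path.Homotopic.Quotient.eq.2 hμ, ← Path.Homotopic.Quotient.mk_symm, Path.refl_symm,
    Path.Homotopic.Quotient.mk_refl, Path.Homotopic.Quotient.trans_refl]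

variable [LocallyCompactSpace X]

theorem exists_pointedMap_of_loop (μ : Path (ContinuousMap.const X A.pt)
    (ContinuousMap.const X A.pt)) : ∃ f : Susp X →⋆ A, ∀ t x, f.1 (Susp.mk (x, t)) = μ t x := by
  obtain ⟨f, hf⟩ := isCylinder_susp.exists_lift_path μ (fun _ => rfl) (fun _ => rfl)
  exact ⟨⟨f, (hf 0 X.pt).trans (by simp)⟩, hf⟩

theorem sigmaLoop_homotopic_iff {f g : Susp X →⋆ A} :
    (sigmaLoop f).Homotopic (sigmaLoop g) ↔ PointedHomotopic f g := by
  refine ⟨fun h => ?_, fun h => homotopic_push_of_pointedHomotopic h (sigmaPath X)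
    (fun _ _ => rfl) (fun _ _ => rfl)⟩
  obtain ⟨f', hf'⟩ := exists_pointedMap_of_loop (sigmaLoop f)
  obtain ⟨g', hg'⟩ := exists_pointedMap_of_loop (sigmaLoop g)
  have h₁ : PointedHomotopic f f' := homotopicRel_sigma fun t x =>
    (hf' t x).trans (sigmaLoop_apply f t x)
  have h₂ : PointedHomotopic g g' := homotopicRel_sigma fun t x =>
    (hg' t x).trans (sigmaLoop_apply g t x)
  have h₃ : PointedHomotopic f' g' := isCylinder_susp.homotopicRel_of_path_homotopic h hf' hg'
    (by rintro _ rfl; exact ⟨X.pt, rfl⟩)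
  exact (h₁.trans h₃).trans h₂.symm

omit [LocallyCompactSpace X] in
theorem addSusp_mk (f g : Susp X →⋆ A) (t : I) (x : X) :
    (addSusp f g).1 (Susp.mk (x, t)) = (sigmaLoop f).trans (sigmaLoop g) t x := by
  change (f.loopMap (Susp.sigma x)).trans (g.loopMap (Susp.sigma x)) t = _
  rw [Path.trans_apply, Path.trans_apply]
  split_ifs
  · exact (sigmaLoop_apply f _ x).symm
  · exact (sigmaLoop_apply g _ x).symm

omit [LocallyCompactSpace X] in
theorem sigmaLoop_addSusp (f g : Susp X →⋆ A) :
    (sigmaLoop (addSusp f g)).Homotopic ((sigmaLoop f).trans (sigmaLoop g)) := by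
  refine sigmaLoop_homotopic_of_eq (addSusp_mk f g) ?_
  rw [basePath, pull_trans (b' := ContinuousMap.const X A.pt) _ _ _ (by simp) (by simp) (by simp)]
  apply Path.Homotopic.Quotient.exact
  rw [Path.Homotopic.Quotient.mk_trans]
  refine (congrArg₂ _ (Path.Homotopic.Quotient.eq.2 (basePath_sigmaLoop_homotopic f))
    (Path.Homotopic.Quotient.eq.2 (basePath_sigmaLoop_homotopic g))).trans ?_
  rw [Path.Homotopic.Quotient.mk_refl, Path.Homotopic.Quotient.trans_refl]

theorem exists_group_susp (X : PointedSpace.{u}) [LocallyCompactSpace X] (A : PointedSpace.{v}) :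
    ∃ _ : Group (HtpyClasses (Susp X) A),
      ∀ f g : Susp X →⋆ A, cls f * cls g = cls (addSusp f g) := by
  let := loopGroup (ContinuousMap.const X A.pt)
  let φ : HtpyClasses (Susp X) A →
      Path.Homotopic.Quotient (ContinuousMap.const X A.pt) (ContinuousMap.const X A.pt) :=
    Quotient.lift (s := pointedSetoid (Susp X) A) (fun f => .mk (sigmaLoop f))
      fun f g h => Path.Homotopic.Quotient.eq.2 (sigmaLoop_homotopic_iff.2 h)
  have hφ : Function.Injective φ := by
    intro a b
    obtain ⟨f, rfl⟩ := cls_surjective a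
    obtain ⟨g, rfl⟩ := cls_surjective b
    intro h
    exact cls_eq_cls_iff.2 (sigmaLoop_homotopic_iff.1 (Path.Homotopic.Quotient.exact h))
  have hadd : ∀ f g : Susp X →⋆ A, φ (cls (addSusp f g)) = φ (cls f) * φ (cls g) := fun f g =>
    (Path.Homotopic.Quotient.eq.2 (sigmaLoop_addSusp f g)).trans
      (Path.Homotopic.Quotient.mk_trans _ _)
  -- The choice of representatives is harmless: φ is injective and takes sums to products, which
  -- also proves that the sum is well defined on classes.
  let mul (a b : HtpyClasses (Susp X) A) : HtpyClasses (Susp X) A :=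
    cls (addSusp (Function.surjInv cls_surjective a) (Function.surjInv cls_surjective b))
  have hmul : ∀ a b, φ (mul a b) = φ a * φ b := fun a b => by
    rw [hadd, Function.surjInv_eq cls_surjective, Function.surjInv_eq cls_surjective]
  have hone : ∃ a, φ a = 1 := by
    obtain ⟨f, hf⟩ := exists_pointedMap_of_loop (Path.refl (ContinuousMap.const X A.pt))
    exact ⟨cls f, Path.Homotopic.Quotient.eq.2
      (sigmaLoop_homotopic_of_eq hf (Path.Homotopic.refl _))⟩
  have hinv : ∀ a, ∃ b, φ b = (φ a)⁻¹ := by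
    intro a
    obtain ⟨f, rfl⟩ := cls_surjective a
    obtain ⟨f', hf'⟩ := exists_pointedMap_of_loop (sigmaLoop f).symm
    exact ⟨cls f', (Path.Homotopic.Quotient.eq.2 (sigmaLoop_homotopic_of_eq hf'
      (basePath_sigmaLoop_homotopic f).symm₂)).trans (Path.Homotopic.Quotient.mk_symm _)⟩
  obtain ⟨inst, h⟩ := exists_group_of_injective hφ mul hmul hone hinv
  exact ⟨inst, fun f g => hφ (by rw [h, hmul, hadd])⟩

end SuspensionGroup

/-! ### Comparing maps out of the join and out of the suspension -/

section JoinComparison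

variable {X Y Z : PointedSpace.{u}} {A : PointedSpace.{v}}

/-- The family of loops `f ∘ ℓ`. -/
noncomputable def ellLoop (f : Join X Y →⋆ A) :
    Path (ContinuousMap.const (X × Y) A.pt) (ContinuousMap.const (X × Y) A.pt) :=
  push f.1 (ellPath X Y) (fun _ => f.2.symm) (fun _ => f.2.symm)

theorem addJoin_mk (f g : Join X Y →⋆ A) (t : I) (r : X × Y) :
    (addJoin f g).1 (joinMk X Y (r, t)) = (ellLoop f).trans (ellLoop g) t r := by
  change (f.loopMap (Join.ell r.1 r.2)).trans (g.loopMap (Join.ell r.1 r.2)) t = _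
  rw [Path.trans_apply, Path.trans_apply]
  split_ifs <;> rfl

theorem ellPath_axisLeft_homotopic :
    (pull (ellPath X Y) (axisLeft X Y.pt) (by simp) (by simp) :
      Path (ContinuousMap.const X (Join X Y).pt) (ContinuousMap.const X (Join X Y).pt)).Homotopic
      (Path.refl _) := by
  let j : C(X, Join X Y) := (joinMk X Y).comp ⟨fun x => ((x, Y.pt), 0), by fun_prop⟩
  let P : Path (ContinuousMap.const X (Join X Y).pt)
      (ContinuousMap.const X (Join.inr Y.pt : Join X Y)) :=
    familyPath ((joinMk X Y).comp ⟨fun r : X × I => ((X.pt, Y.pt), r.2), by fun_prop⟩) _ _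
      (fun _ => rfl) (fun _ => rfl)
  let Q : Path j (ContinuousMap.const X (Join.inr Y.pt : Join X Y)) :=
    familyPath ((joinMk X Y).comp ⟨fun r : X × I => ((r.1, Y.pt), r.2), by fun_prop⟩) _ _
      (fun _ => rfl) (fun x => isCylinder_join.eq_one (w := (x, Y.pt)) (w' := (X.pt, Y.pt)) rfl)
  have h : (pull (ellPath X Y) (axisLeft X Y.pt) (by simp) (by simp) :
      Path (ContinuousMap.const X (Join X Y).pt) (ContinuousMap.const X (Join X Y).pt)) =
      ((P.trans Q.symm).trans Q).trans P.symm := by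
    refine path_ext₂ fun t x => ?_
    change Join.ell x Y.pt t = _
    simp only [ell_eval, Path.trans_apply]
    split_ifs <;> rfl
  rw [h]
  apply Path.Homotopic.Quotient.exact
  simp only [Path.Homotopic.Quotient.mk_trans, Path.Homotopic.Quotient.mk_symm,
    Path.Homotopic.Quotient.trans_assoc, Path.Homotopic.Quotient.mk_refl]
  rw [← Path.Homotopic.Quotient.trans_assoc (Path.Homotopic.Quotient.symm _),
    Path.Homotopic.Quotient.symm_trans, Path.Homotopic.Quotient.refl_trans,
    Path.Homotopic.Quotient.trans_symm]

theorem ellPath_axisRight_homotopic :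
    (pull (ellPath X Y) (axisRight X.pt Y) (by simp) (by simp) :
      Path (ContinuousMap.const Y (Join X Y).pt) (ContinuousMap.const Y (Join X Y).pt)).Homotopic
      (Path.refl _) := by
  let j : C(Y, Join X Y) := (joinMk X Y).comp ⟨fun y => ((X.pt, y), 1), by fun_prop⟩
  let P : Path (ContinuousMap.const Y (Join X Y).pt)
      (ContinuousMap.const Y (Join.inr Y.pt : Join X Y)) :=
    familyPath ((joinMk X Y).comp ⟨fun r : Y × I => ((X.pt, Y.pt), r.2), by fun_prop⟩) _ _
      (fun _ => rfl) (fun _ => rfl)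
  let Q : Path (ContinuousMap.const Y (Join X Y).pt) j :=
    familyPath ((joinMk X Y).comp ⟨fun r : Y × I => ((X.pt, r.1), r.2), by fun_prop⟩) _ _
      (fun y => isCylinder_join.eq_zero (w := (X.pt, y)) (w' := (X.pt, Y.pt)) rfl) (fun _ => rfl)
  have h : (pull (ellPath X Y) (axisRight X.pt Y) (by simp) (by simp) :
      Path (ContinuousMap.const Y (Join X Y).pt) (ContinuousMap.const Y (Join X Y).pt)) =
      ((P.trans P.symm).trans Q).trans Q.symm := by
    refine path_ext₂ fun t y => ?_
    change Join.ell X.pt y t = _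
    simp only [ell_eval, Path.trans_apply]
    split_ifs <;> rfl
  rw [h]
  apply Path.Homotopic.Quotient.exact
  simp only [Path.Homotopic.Quotient.mk_trans, Path.Homotopic.Quotient.mk_symm,
    Path.Homotopic.Quotient.trans_symm, Path.Homotopic.Quotient.refl_trans,
    Path.Homotopic.Quotient.mk_refl]

variable [LocallyCompactSpace X] [LocallyCompactSpace Y]

theorem addJoin_congr {f f' g g' : Join X Y →⋆ A} (hf : PointedHomotopic f f')
    (hg : PointedHomotopic g g') : PointedHomotopic (addJoin f g) (addJoin f' g') := by
  have h₁ : (ellLoop f).Homotopic (ellLoop f') :=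
    homotopic_push_of_pointedHomotopic hf (ellPath X Y) (fun _ _ => rfl) (fun _ _ => rfl)
  have h₂ : (ellLoop g).Homotopic (ellLoop g') :=
    homotopic_push_of_pointedHomotopic hg (ellPath X Y) (fun _ _ => rfl) (fun _ _ => rfl)
  exact isCylinder_join.homotopicRel_of_path_homotopic (h₁.hcomp h₂) (addJoin_mk f g)
    (addJoin_mk f' g') (by rintro _ rfl; exact ⟨(X.pt, Y.pt), rfl⟩)

variable [LocallyCompactSpace Z] {c : C(X × Y, Z)}

omit [LocallyCompactSpace X] [LocallyCompactSpace Y] in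
theorem ellLoop_comp_joinToSusp (h0 : ∀ y, c (X.pt, y) = Z.pt)
    (hc : (c.comp (axisLeft X Y.pt)).Homotopic (ContinuousMap.const X Z.pt)) (f : Susp Z →⋆ A) :
    (ellLoop (f.comp (joinToSusp c))).Homotopic
      (pull (sigmaLoop f) c (fun _ => rfl) (fun _ => rfl)) := by
  have h := joinToSusp_ell_homotopic h0 hc
    (μ := push (joinToSusp c).1 (ellPath X Y) (fun _ => (joinToSusp c).2.symm)
      (fun _ => (joinToSusp c).2.symm))
    (ν := pull (sigmaPath Z) c (by simp) (by simp)) (fun _ _ => rfl)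
    (fun t r => sigmaPath_apply t (c r))
  exact homotopic_push h f.1 (a' := ContinuousMap.const (X × Y) A.pt)
    (b' := ContinuousMap.const (X × Y) A.pt) (fun _ => f.2.symm) (fun _ => f.2.symm)

theorem addSusp_comp_joinToSusp (h0 : ∀ y, c (X.pt, y) = Z.pt)
    (hc : (c.comp (axisLeft X Y.pt)).Homotopic (ContinuousMap.const X Z.pt)) (f g : Susp Z →⋆ A) :
    PointedHomotopic ((addSusp f g).comp (joinToSusp c))
      (addJoin (f.comp (joinToSusp c)) (g.comp (joinToSusp c))) := by
  have h := (ellLoop_comp_joinToSusp h0 hc f).hcomp (ellLoop_comp_joinToSusp h0 hc g)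
  refine isCylinder_join.homotopicRel_of_path_homotopic h.symm (fun t r => ?_) (addJoin_mk _ _)
    (by rintro _ rfl; exact ⟨(X.pt, Y.pt), rfl⟩)
  refine (addSusp_mk f g t (c r)).trans ?_
  rw [Path.trans_apply, Path.trans_apply]
  split_ifs <;> rfl

omit [LocallyCompactSpace Z] in
-- The image of all inr y slides from the south to the north pole along the base meridian, away from
-- the base point.
theorem joinToSusp_homotopic_loop (c : C(X × Y, Z)) :
    PointedHomotopic (joinToSusp c) (joinToSuspLoop c) := by
  refine isCylinder_join.homotopicRel_of_trans
    (μ := (pull (meridPath Z) c (by simp) (by simp) :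
      Path (ContinuousMap.const (X × Y) (Susp Z).pt)
        (ContinuousMap.const (X × Y) (Susp.south : Susp Z))))
    (pull (meridPathBase Z) c (by simp) (by simp) :
      Path (ContinuousMap.const (X × Y) (Susp Z).pt)
        (ContinuousMap.const (X × Y) (Susp.south : Susp Z))).symm
    (fun _ _ => rfl) (fun t r => ?_) (fun _ _ => rfl)
    (by rintro _ rfl; exact ⟨(X.pt, Y.pt), rfl⟩)
  change Susp.sigma (c r) t = _
  rw [← sigmaPath_apply, sigmaPath, Path.trans_apply, Path.trans_apply]
  split_ifs <;> rfl

theorem pointedHomotopic_of_comp_joinToSusp (hs : IsSmashLike.{v} c X.pt Y.pt)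
    (h0 : ∀ y, c (X.pt, y) = Z.pt)
    (hc : (c.comp (axisLeft X Y.pt)).Homotopic (ContinuousMap.const X Z.pt)) {f g : Susp Z →⋆ A}
    (h : PointedHomotopic (f.comp (joinToSusp c)) (g.comp (joinToSusp c))) :
    PointedHomotopic f g := by
  let F : Path (ContinuousMap.const (X × Y) A.pt) (ContinuousMap.const (X × Y) A.pt) :=
    pull (sigmaLoop f) c (fun _ => rfl) (fun _ => rfl)
  let G : Path (ContinuousMap.const (X × Y) A.pt) (ContinuousMap.const (X × Y) A.pt) :=
    pull (sigmaLoop g) c (fun _ => rfl) (fun _ => rfl)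
  have h₁ : (ellLoop (f.comp (joinToSusp c))).Homotopic (ellLoop (g.comp (joinToSusp c))) :=
    homotopic_push_of_pointedHomotopic h (ellPath X Y) (fun _ _ => rfl) (fun _ _ => rfl)
  have h₂ : F.Homotopic G := (ellLoop_comp_joinToSusp h0 hc f).symm.trans
    (h₁.trans (ellLoop_comp_joinToSusp h0 hc g))
  -- The smash property detects only null homotopies, so it is applied to the difference of the two
  -- families of loops.
  have h₃ : (F.trans G.symm).Homotopic (Path.refl _) :=
    (h₂.hcomp (Path.Homotopic.refl _)).trans (Path.Homotopic.trans_symm _)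
  have h₄ : ((sigmaLoop f).trans (sigmaLoop g).symm).Homotopic (Path.refl _) := by
    refine hs.path_homotopic_refl (fun t r => ?_) h₃
    rw [Path.trans_apply, Path.trans_apply]
    split_ifs <;> rfl
  refine sigmaLoop_homotopic_iff.1 (Path.Homotopic.Quotient.exact ?_)
  have h₅ := congrArg (fun z => Path.Homotopic.Quotient.trans z (.mk (sigmaLoop g)))
    (Path.Homotopic.Quotient.eq.2 h₄)
  simpa only [Path.Homotopic.Quotient.mk_trans, Path.Homotopic.Quotient.mk_symm,
    Path.Homotopic.Quotient.trans_assoc, Path.Homotopic.Quotient.symm_trans,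
    Path.Homotopic.Quotient.trans_refl, Path.Homotopic.Quotient.mk_refl,
    Path.Homotopic.Quotient.refl_trans] using h₅

/-- On either axis ℓ cancels against itself, so f ∘ ℓ descends along `c` to a family over `Z`, which
defines `g`. Well-pointedness serves to recover `f` from f ∘ ℓ. -/
theorem exists_comp_joinToSusp (hX : WellPointed X) (hs : IsSmashLike.{v} c X.pt Y.pt)
    (f : Join X Y →⋆ A) : ∃ g : Susp Z →⋆ A, PointedHomotopic (g.comp (joinToSusp c)) f := by
  have hX' := homotopic_push ellPath_axisLeft_homotopic f.1
    (a' := ContinuousMap.const X A.pt) (b' := ContinuousMap.const X A.pt)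
    (fun _ => f.2.symm) (fun _ => f.2.symm)
  have hY' := homotopic_push ellPath_axisRight_homotopic f.1
    (a' := ContinuousMap.const Y A.pt) (b' := ContinuousMap.const Y A.pt)
    (fun _ => f.2.symm) (fun _ => f.2.symm)
  have hX'' : push f.1 (Path.refl (ContinuousMap.const X (Join X Y).pt))
      (a' := ContinuousMap.const X A.pt) (b' := ContinuousMap.const X A.pt)
      (fun _ => f.2.symm) (fun _ => f.2.symm) = Path.refl _ := path_ext₂ fun _ _ => f.2
  have hY'' : push f.1 (Path.refl (ContinuousMap.const Y (Join X Y).pt))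
      (a' := ContinuousMap.const Y A.pt) (b' := ContinuousMap.const Y A.pt)
      (fun _ => f.2.symm) (fun _ => f.2.symm) = Path.refl _ := path_ext₂ fun _ _ => f.2
  rw [hX''] at hX'
  rw [hY''] at hY'
  obtain ⟨μ, hμ⟩ := hs.exists_path (ellLoop f) (fun _ _ => rfl) (fun _ _ => rfl) hX' hY'
  obtain ⟨g, hg⟩ := exists_pointedMap_of_loop μ
  obtain ⟨f', hf'⟩ := isCylinder_join.exists_lift_path (ellLoop f) (fun _ => rfl) (fun _ => rfl)
  have h₁ : f.1.HomotopicRel f' {(Join X Y).pt} := homotopicRel_ell hX hf'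
  have h₂ : (g.comp (joinToSusp c)).1.HomotopicRel f' {(Join X Y).pt} :=
    isCylinder_join.homotopicRel_of_path_homotopic
      (hμ (pull μ c (by simp) (by simp)) fun _ _ => rfl) (fun t r => hg t (c r)) hf'
      (by rintro _ rfl; exact ⟨(X.pt, Y.pt), rfl⟩)
  exact ⟨g, h₂.trans h₁.symm⟩

end JoinComparison

end JoinHomotopy

open JoinHomotopy
theorem proposition6p9 (n m : ℕ) (A : PointedSpace.{u}) :
    ∃ (_ : Group (HtpyGroup (m + n + 1) A)) (_ : Group (HtpyGroupStar n m A)),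
      (∀ f g : Sphere (m + n + 1) →⋆ A, HtpyGroup.mk f * HtpyGroup.mk g = HtpyGroup.mk (addSphere f g)) ∧
      (∀ f g : Join (Sphere n) (Sphere m) →⋆ A,
        HtpyGroupStar.mk f * HtpyGroupStar.mk g = HtpyGroupStar.mk (addJoin f g)) ∧
      (∀ f g : Sphere (m + n + 1) →⋆ A,
        PointedHomotopic ((addSphere f g).comp (sphereJoinMap n m))
          (addJoin (f.comp (sphereJoinMap n m)) (g.comp (sphereJoinMap n m)))) ∧
      ∃ e : HtpyGroup (m + n + 1) A ≃* HtpyGroupStar n m A, ∀ f : Sphere (m + n + 1) →⋆ A,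
        e (HtpyGroup.mk f) = HtpyGroupStar.mk (f.comp (sphereJoinMap n m)) ∧
        e (HtpyGroup.mk f) = HtpyGroupStar.mk (f.comp (sphereJoinMapLoop n m)) := by
  have h0 := cup_pt_left n m
  have hc := cup_axisLeft_homotopic_const n m
  have hs := isSmashLike_cup.{u} n m
  obtain ⟨inst, hadd⟩ := exists_group_susp (Sphere (m + n)) A
  let φ : HtpyGroup (m + n + 1) A → HtpyGroupStar n m A :=
    Quotient.map (sa := pointedSetoid (Susp (Sphere (m + n))) A)
      (sb := pointedSetoid (Join (Sphere n) (Sphere m)) A)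
      (fun f => f.comp (sphereJoinMap n m)) fun f g h => by
        obtain ⟨H⟩ := h
        exact ⟨{ toContinuousMap := H.toContinuousMap.comp
                  ⟨fun r => (r.1, (sphereJoinMap n m).1 r.2), by fun_prop⟩
                 map_zero_left := fun x => H.map_zero_left _
                 map_one_left := fun x => H.map_one_left _
                 prop' := by
                  rintro s _ rfl
                  exact H.eq_fst s (sphereJoinMap n m).2 }⟩
  have hφ : Function.Bijective φ := by
    constructor
    · intro a b
      obtain ⟨f, rfl⟩ := cls_surjective a
      obtain ⟨g, rfl⟩ := cls_surjective b
      intro h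
      exact cls_eq_cls_iff.2 (pointedHomotopic_of_comp_joinToSusp hs h0 hc (cls_eq_cls_iff.1 h))
    · intro b
      obtain ⟨f, rfl⟩ := cls_surjective b
      obtain ⟨g, hg⟩ := exists_comp_joinToSusp (wellPointed_sphere n) hs f
      exact ⟨cls g, cls_eq_cls_iff.2 hg⟩
  let e := Equiv.ofBijective φ hφ
  let : Group (HtpyGroup (m + n + 1) A) := inst
  -- Transporting the structure leaves only the formula for the product to be checked.
  let inst' : Group (HtpyGroupStar n m A) := e.symm.group
  have h3 : ∀ f g : Sphere (m + n + 1) →⋆ A,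
      PointedHomotopic ((addSphere f g).comp (sphereJoinMap n m))
        (addJoin (f.comp (sphereJoinMap n m)) (g.comp (sphereJoinMap n m))) :=
    addSusp_comp_joinToSusp h0 hc
  refine ⟨inst, inst', hadd, fun f g => ?_, h3, e.symm.mulEquiv.symm, fun f => ⟨rfl, ?_⟩⟩
  -- Up to pointed homotopy both maps factor through `F`; there the formula is the compatibility
  -- `h3`, and `addJoin_congr` returns to the given maps.
  · obtain ⟨f', hf⟩ := exists_comp_joinToSusp (wellPointed_sphere n) hs f
    obtain ⟨g', hg⟩ := exists_comp_joinToSusp (wellPointed_sphere n) hs g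
    have hf' : HtpyGroupStar.mk f = e (HtpyGroup.mk f') := (cls_eq_cls_iff.2 hf).symm
    have hg' : HtpyGroupStar.mk g = e (HtpyGroup.mk g') := (cls_eq_cls_iff.2 hg).symm
    rw [hf', hg']
    refine (e.symm.mulEquiv.symm.map_mul (HtpyGroup.mk f') (HtpyGroup.mk g')).symm.trans ?_
    refine (congrArg e (hadd f' g')).trans ?_
    exact cls_eq_cls_iff.2 ((h3 f' g').trans (addJoin_congr hf hg))
  · exact cls_eq_cls_iff.2 ((joinToSusp_homotopic_loop (cup n m)).comp_continuousMap f.1)
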